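/- Fix a field $k$. All simplicial complexes are finite, abstract, and contain the empty face. The link of a face $F$ of $\Delta$ is $\mathrm{link}_\Delta(F)=\{G\setminus F: F\subseteq G\in\Delta\}$. A complex $\Delta$ is a \emph{homology sphere} if for every $F\in\Delta$ the reduced simplicial homology $\widetilde H_i(\mathrm{link}_\Delta(F);k)$ is $k$ for $i=\dim \mathrm{link}_\Delta(F)$ and $0$ for all other $i$. A complex $\Delta$ is a \emph{homology ball} with boundary $\partial\Delta$ if $\partial\Delta$ is a subcomplex of $\Delta$ which is a homology sphere of dimension $\dim\Delta-1$, and for every $F\in\Delta$ the group $\widetilde H_i(\mathrm{link}_\Delta(F);k)$ is $k$ if $F\notin\partial\Delta$ and $i=\dim\mathrm{link}_\Delta(F)$, and $0$ otherwise. A complex is \emph{flag} if every set of its vertices which are pairwise joined by edges is a face. A subcomplex $\Gamma$ of $\Delta$ is \emph{induced} if it contains every face of $\Delta$ all of whose vertices belong to $\Gamma$. The $h$-polynomial of an $(n-1)$-dimensional complex with $f_{i-1}$ faces of cardinality $i$ is $h(\Delta,x)=\sum_{i=0}^n f_{i-1}x^i(1-x)^{n-i}$, and $\theta(\Delta,x)=h(\Delta,x)-h(\partial\Delta,x)$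 for a homology ball $\Delta$. A polynomial $p\in\mathbb R[x]$ is \emph{$\gamma$-positive} with center of symmetry $n/2$ if $p(x)=\sum_{i=0}^{\lfloor n/2\rfloor}\gamma_i x^i(1+x)^{n-2i}$ for some nonnegative reals $\gamma_i$. The \emph{$\gamma$-polynomial} of an $(n-1)$-dimensional homology sphere $\Delta$ is $\gamma(\Delta,x)=\sum_{i=0}^{\lfloor n/2\rfloor}\gamma_i x^i$, where $h(\Delta,x)=\sum_{i=0}^{\lfloor n/2\rfloor}\gamma_i x^i(1+x)^{n-2i}$. Inequalities between polynomials are coefficientwise. For every positive integer $n$ the following statements are equivalent: (i) $\theta(\Delta,x)$ is $\gamma$-positive, with center of symmetry $n/2$, for every $(n-1)$-dimensional flag homology ball $\Delta$ such that $\partial\Delta$ is an induced subcomplex of $\Delta$; (ii) $\gamma(\Delta,x)\ge\gamma(\mathrm{link}_\Delta(v),x)$ for every $(n-1)$-dimensional flag homology sphere $\Delta$ and every vertex $v$ of $\Delta$; (iii) $\gamma(\Delta,x)\ge\gamma(\Gamma,x)$ for every $(n-1)$-dimensional flag homology sphere $\Delta$ and every $(n-2)$-dimensional flag homology sphere $\Gamma$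 which is an induced subcomplex of $\Delta$. -/

import Mathlib

universe u

open Polynomial

set_option maxSynthPendingDepth 3

/-- A finite abstract simplicial complex on a ground set `V`: a finite family of finite subsets of
`V`, closed under passing to subsets. As usual for face enumeration and for reduced homology, the
empty set is a face of every complex (so `{∅}` is the complex of dimension `-1`). Elements of `V`
need not be vertices. -/
@[ext]
structure FiniteComplex (V : Type*) where
  faces : Finset (Finset V)
  empty_mem : ∅ ∈ faces
  down_closed : ∀ {F G : Finset V}, G ∈ faces → F ⊆ G → F ∈ faces

namespace FiniteComplex

section Basic

variable {V : Type*} [DecidableEq V]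

/-- `rank Δ = dim Δ + 1`, the largest cardinality of a face. -/
def rank (Δ : FiniteComplex V) : ℕ := Δ.faces.sup Finset.card

/-- The dimension of a complex; it is `-1` for the complex `{∅}`. -/
def dim (Δ : FiniteComplex V) : ℤ := (Δ.rank : ℤ) - 1

/-- The link of a face `F`: all faces `G` disjoint from `F` such that `F ∪ G` is a face. -/
def link (Δ : FiniteComplex V) (F : Finset V) (hF : F ∈ Δ.faces) : FiniteComplex V where
  faces := Δ.faces.filter (fun G => Disjoint F G ∧ F ∪ G ∈ Δ.faces)
  empty_mem := by simp [Δ.empty_mem, hF]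
  down_closed := by
    intro G H hH hGH
    simp only [Finset.mem_filter] at hH ⊢
    exact ⟨Δ.down_closed hH.1 hGH, Finset.disjoint_of_subset_right hGH hH.2.1,
      Δ.down_closed hH.2.2 (Finset.union_subset_union_right hGH)⟩

/-- A complex is flag if every set of vertices that are pairwise joined by edges is a face. -/
def IsFlag (Δ : FiniteComplex V) : Prop :=
  ∀ F : Finset V, (∀ u ∈ F, ∀ v ∈ F, ({u, v} : Finset V) ∈ Δ.faces) → F ∈ Δ.faces

/-- `Γ` is an induced subcomplex of `Δ`: it is a subcomplex, and it contains every face of `Δ` all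
of whose vertices are vertices of `Γ`. -/
def IsInducedSubcomplex (Γ Δ : FiniteComplex V) : Prop :=
  Γ.faces ⊆ Δ.faces ∧
    ∀ F ∈ Δ.faces, (∀ v ∈ F, ({v} : Finset V) ∈ Γ.faces) → F ∈ Γ.faces

/-- `Δ.faceCount i` is the number of faces with `i` elements, that is, `f_{i-1}(Δ)`. -/
def faceCount (Δ : FiniteComplex V) (i : ℕ) : ℕ := (Δ.faces.filter (fun F => F.card = i)).card

/-- The `h`-polynomial `∑_{i=0}^{n} f_{i-1}(Δ) x^i (1-x)^{n-i}`, where `n = dim Δ + 1`. -/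
noncomputable def hPoly (Δ : FiniteComplex V) : ℝ[X] :=
  ∑ i ∈ Finset.range (Δ.rank + 1), C (Δ.faceCount i : ℝ) * X ^ i * (1 - X) ^ (Δ.rank - i)

/-- The theta polynomial `h(Δ, x) - h(∂Δ, x)` of a homology ball `Δ` with boundary `B = ∂Δ`. -/
noncomputable def thetaPoly (Δ B : FiniteComplex V) : ℝ[X] := Δ.hPoly - B.hPoly

end Basic

section Homology

variable {V : Type*} [LinearOrder V] (k : Type*) [Field k]

/-- The simplicial boundary operator
`[v_0 < ⋯ < v_m] ↦ ∑_j (-1)^j [v_0, …, v_{j-1}, v_{j+1}, …, v_m]`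
on formal `k`-linear combinations of finite subsets of `V`. Subsets are oriented by the linear
order of `V`; the position `j` of `v` in `F` is the number of elements of `F` below `v`. -/
noncomputable def boundary : (Finset V →₀ k) →ₗ[k] (Finset V →₀ k) :=
  Finsupp.linearCombination k fun F : Finset V =>
    ∑ v ∈ F, ((-1 : k) ^ (F.filter (fun w => w < v)).card) • Finsupp.single (F.erase v) (1 : k)

/-- The boundary operator squares to zero. -/
theorem boundary_boundary (c : Finset V →₀ k) : boundary k (boundary k c) = 0 := by
  unfold boundary
  induction c using Finsupp.induction_linear with
  | zero => simp
  | add f g hf hg => simp only [map_add, hf, hg, add_zero]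
  | single F a =>
    simp only [Finsupp.linearCombination_single, map_smul, map_sum, one_smul, Finset.smul_sum]
    simp only [← Finset.smul_sum]
    convert smul_zero a
    simp only [Finset.smul_sum]
    rw [Finset.sum_sigma']
    have key : ∀ v ∈ F, ∀ w ∈ F, v < w →
        (-1 : k) ^ (F.filter (fun x => x < v)).card *
            (-1) ^ ((F.erase v).filter (fun x => x < w)).card +
          (-1 : k) ^ (F.filter (fun x => x < w)).card *
            (-1) ^ ((F.erase w).filter (fun x => x < v)).card = 0 := by
      intro v hv w hw h
      have h1 : (F.erase w).filter (fun x => x < v) = F.filter (fun x => x < v) := by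
        ext x; simp only [Finset.mem_filter, Finset.mem_erase]
        exact ⟨fun hx => ⟨hx.1.2, hx.2⟩, fun hx => ⟨⟨(hx.2.trans h).ne, hx.1⟩, hx.2⟩⟩
      have h2 : (F.erase v).filter (fun x => x < w) = (F.filter (fun x => x < w)).erase v := by
        rw [Finset.filter_erase]
      have h3 : (F.filter (fun x => x < w)).card
          = ((F.filter (fun x => x < w)).erase v).card + 1 :=
        (Finset.card_erase_add_one (by simp [hv, h])).symm
      rw [h1, h2, h3]; ring
    refine Finset.sum_involution (fun p _ => ⟨p.2, p.1⟩) ?_ ?_ ?_ ?_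
    · rintro ⟨v, w⟩ h
      simp only [Finset.mem_sigma, Finset.mem_erase] at h
      obtain ⟨hv, hwv, hw⟩ := h
      simp only [smul_smul]
      rw [Finset.erase_right_comm (a := w), ← add_smul]
      rcases lt_or_gt_of_ne hwv with h | h
      · rw [add_comm, key w hw v hv h, zero_smul]
      · rw [key v hv w hw h, zero_smul]
    · rintro ⟨v, w⟩ h _ h'
      simp only [Finset.mem_sigma, Finset.mem_erase] at h
      simp only [Sigma.mk.injEq] at h'
      exact h.2.1 h'.1
    · rintro ⟨v, w⟩ h
      simp only [Finset.mem_sigma, Finset.mem_erase] at h ⊢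
      exact ⟨h.2.2, h.2.1.symm, h.1⟩
    · rintro ⟨v, w⟩ h
      rfl

/-- The space of (augmented) simplicial `i`-chains of `Δ`, spanned by the faces with `i + 1`
elements. -/
noncomputable def chains (Δ : FiniteComplex V) (i : ℤ) : Submodule k (Finset V →₀ k) :=
  Finsupp.supported k k {F | F ∈ Δ.faces ∧ (F.card : ℤ) = i + 1}

/-- The space of `i`-cycles of `Δ`. -/
noncomputable def cycles (Δ : FiniteComplex V) (i : ℤ) : Submodule k (Finset V →₀ k) :=
  Δ.chains k i ⊓ LinearMap.ker (boundary k)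

/-- The space of `i`-boundaries of `Δ`. -/
noncomputable def boundaries (Δ : FiniteComplex V) (i : ℤ) : Submodule k (Finset V →₀ k) :=
  (Δ.chains k (i + 1)).map (boundary k)

/-- Boundaries are cycles. -/
theorem boundaries_le_cycles (Δ : FiniteComplex V) (i : ℤ) :
    Δ.boundaries k i ≤ Δ.cycles k i := by
  rintro _ ⟨c, hc, rfl⟩
  refine ⟨?_, boundary_boundary k c⟩
  simp only [boundary, Finsupp.linearCombination_apply, Finsupp.sum]
  refine Submodule.sum_mem _ fun F hF => Submodule.smul_mem _ _ (Submodule.sum_mem _ fun v hv =>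
    Submodule.smul_mem _ _ (Finsupp.single_mem_supported k 1 ?_))
  have hF' := (Finsupp.mem_supported k c).1 hc hF
  simp only [Set.mem_ofPred_eq] at hF' ⊢
  refine ⟨Δ.down_closed hF'.1 (Finset.erase_subset v F), ?_⟩
  have := Finset.card_erase_add_one hv
  omega

/-- The reduced simplicial homology of `Δ` in degree `i` with coefficients in `k`: cycles modulo
boundaries. -/
abbrev ReducedHomology (Δ : FiniteComplex V) (i : ℤ) : Type _ :=
  (Δ.cycles k i) ⧸ (Δ.boundaries k i).submoduleOf (Δ.cycles k i)

/-- `Δ` is a homology sphere over `k`: the reduced homology of the link of every face is `k` in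
degree the dimension of the link, and zero in all other degrees. -/
def IsHomologySphere (Δ : FiniteComplex V) : Prop :=
  ∀ (F : Finset V) (hF : F ∈ Δ.faces) (i : ℤ),
    (i = (Δ.link F hF).dim → Nonempty ((Δ.link F hF).ReducedHomology k i ≃ₗ[k] k)) ∧
    (i ≠ (Δ.link F hF).dim → Subsingleton ((Δ.link F hF).ReducedHomology k i))

/-- `Δ` is a homology ball over `k` with boundary `B`: `B` is a subcomplex of `Δ` and a homology
sphere of dimension `dim Δ - 1`, and for every face `F` of `Δ` the reduced homology of the link of
`F` is `k` in degree the dimension of the link if `F` is not in `B`, and zero otherwise. (These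
conditions determine `B`.) -/
def IsHomologyBall (Δ B : FiniteComplex V) : Prop :=
  B.faces ⊆ Δ.faces ∧ B.IsHomologySphere k ∧ B.dim = Δ.dim - 1 ∧
  ∀ (F : Finset V) (hF : F ∈ Δ.faces) (i : ℤ),
    ((F ∉ B.faces ∧ i = (Δ.link F hF).dim) →
      Nonempty ((Δ.link F hF).ReducedHomology k i ≃ₗ[k] k)) ∧
    (¬ (F ∉ B.faces ∧ i = (Δ.link F hF).dim) →
      Subsingleton ((Δ.link F hF).ReducedHomology k i))

end Homology

end FiniteComplex

/-- `g = ∑_i γ_i x^i` is the `γ`-polynomial of `p` with respect to the center of symmetry `n/2`: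
it has degree at most `⌊n/2⌋` and `p = ∑_{i=0}^{⌊n/2⌋} γ_i x^i (1+x)^{n-2i}`.
(There is at most one such `g`.) -/
def IsGammaPolynomial (n : ℕ) (p g : ℝ[X]) : Prop :=
  g.natDegree ≤ n / 2 ∧
    p = ∑ i ∈ Finset.range (n / 2 + 1), C (g.coeff i) * X ^ i * (1 + X) ^ (n - 2 * i)

/-- `p` is `γ`-positive with center of symmetry `n/2`. -/
def IsGammaPositive (n : ℕ) (p : ℝ[X]) : Prop :=
  ∃ γ : ℕ → ℝ, (∀ i, 0 ≤ γ i) ∧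
    p = ∑ i ∈ Finset.range (n / 2 + 1), C (γ i) * X ^ i * (1 + X) ^ (n - 2 * i)

/-- The coefficientwise inequality `γ(Γ, x) ≤ γ(Δ, x)`: the `h`-polynomials of `Γ` and `Δ` have
`γ`-polynomials, each with respect to the center `(dim + 1)/2`, and every coefficient of the former
is at most the corresponding coefficient of the latter. -/
def GammaLE {V : Type*} [DecidableEq V] (Γ Δ : FiniteComplex V) : Prop :=
  ∃ g g' : ℝ[X], IsGammaPolynomial Γ.rank Γ.hPoly g ∧ IsGammaPolynomial Δ.rank Δ.hPoly g' ∧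
    ∀ i : ℕ, g.coeff i ≤ g'.coeff i

namespace FiniteComplex

/-! ### Ranks and iterated links -/

section Basic

variable {V : Type*}

/-! The bridge between balls and spheres is an identity of h-polynomials. If a sphere Δ is cut along
a codimension-one sphere Γ into balls D₁ and D₂, inclusion–exclusion gives h(Δ) = θ(D₁) + θ(D₂) + (1
+ x) h(Γ) (`IsDecomposition.hPoly_eq`). Multiplying by 1 + x moves the center of symmetry by one
half and leaves the γ-coefficients alone (`IsGammaPolynomial.one_add_X_mul`), so γ(Δ) - γ(Γ)
collects the γ-coefficients of the two thetas.

(i) ⇒ (iii): an induced sphere Γ does cut Δ into two balls with boundary Γ. Separation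
(`IsInducedSubcomplex.exists_isDecomposition`) comes from a chain bounded by the fundamental cycle
of Γ: off Γ it is a locally constant multiple of the fundamental cycle of Δ, and the multiple takes
more than one value. That the pieces are balls (`IsDecomposition.isHomologyBall_left`) is a
Mayer–Vietoris argument applied to Δ and to links. The pieces are induced subcomplexes, hence flag.

(iii) ⇒ (ii): in a flag complex the link of a vertex is flag and induced.

(ii) ⇒ (i): coning off the boundary B of a ball Δ gives a sphere (`IsHomologyBall.coneOff`), flag
because B is induced. The link of the apex is B, and the h-polynomial is h(Δ) + x h(B) = θ(Δ) + (1 +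
x) h(B), so the link inequality says that θ(Δ) is γ-positive.

The γ-polynomials exist by the Dehn–Sommerville relations (`IsHomologySphere.hPoly_eq`). -/

theorem card_le_rank (Δ : FiniteComplex V) {F : Finset V} (hF : F ∈ Δ.faces) :
    F.card ≤ Δ.rank := Finset.le_sup (f := Finset.card) hF

theorem exists_card_eq_rank (Δ : FiniteComplex V) : ∃ F ∈ Δ.faces, F.card = Δ.rank := by
  obtain ⟨F, hF, h⟩ := Finset.exists_mem_eq_sup Δ.faces ⟨∅, Δ.empty_mem⟩ Finset.card
  exact ⟨F, hF, h.symm⟩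

theorem rank_le_of_forall {Δ : FiniteComplex V} {m : ℕ} (h : ∀ F ∈ Δ.faces, F.card ≤ m) :
    Δ.rank ≤ m := Finset.sup_le h

theorem rank_eq_of_forall {Δ : FiniteComplex V} {m : ℕ} (h : ∀ F ∈ Δ.faces, F.card ≤ m)
    {F : Finset V} (hF : F ∈ Δ.faces) (hm : F.card = m) : Δ.rank = m :=
  le_antisymm (rank_le_of_forall h) (hm ▸ Δ.card_le_rank hF)

variable [DecidableEq V]

theorem mem_link {Δ : FiniteComplex V} {F : Finset V} {hF : F ∈ Δ.faces} {G : Finset V} :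
    G ∈ (Δ.link F hF).faces ↔ Disjoint F G ∧ F ∪ G ∈ Δ.faces := by
  simp only [link, Finset.mem_filter, and_iff_right_iff_imp]
  exact fun h => Δ.down_closed h.2 Finset.subset_union_right

theorem mem_link_singleton {Δ : FiniteComplex V} {v : V} {hv : {v} ∈ Δ.faces} {G : Finset V} :
    G ∈ (Δ.link {v} hv).faces ↔ v ∉ G ∧ insert v G ∈ Δ.faces := by
  rw [mem_link, Finset.disjoint_singleton_left, Finset.insert_eq]

theorem link_link (Δ : FiniteComplex V) {F G : Finset V} (hF : F ∈ Δ.faces)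
    (hG : G ∈ (Δ.link F hF).faces) :
    (Δ.link F hF).link G hG = Δ.link (F ∪ G) (mem_link.1 hG).2 := by
  ext H
  have h := (mem_link.1 hG).1
  simp only [mem_link, Finset.disjoint_union_left, Finset.disjoint_union_right, Finset.union_assoc]
  tauto

theorem link_empty (Δ : FiniteComplex V) : Δ.link ∅ Δ.empty_mem = Δ := by
  ext H
  simp [mem_link]

theorem link_congr (Δ : FiniteComplex V) {F G : Finset V} (h : F = G) (hF : F ∈ Δ.faces)
    (hG : G ∈ Δ.faces) : Δ.link F hF = Δ.link G hG := by
  subst h; rfl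

theorem rank_link_add_card_le (Δ : FiniteComplex V) {F : Finset V} (hF : F ∈ Δ.faces) :
    (Δ.link F hF).rank + F.card ≤ Δ.rank := by
  obtain ⟨G, hG, h⟩ := (Δ.link F hF).exists_card_eq_rank
  obtain ⟨h1, h2⟩ := mem_link.1 hG
  have := Δ.card_le_rank h2
  rw [Finset.card_union_of_disjoint h1] at this
  omega

end Basic

/-! ### Chains, contraction by a vertex, and explicit descriptions of homology -/

section Faces

variable {V : Type*} {k : Type*} [Field k]

theorem mem_chains {Δ : FiniteComplex V} {i : ℤ} {c : Finset V →₀ k} :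
    c ∈ Δ.chains k i ↔ ∀ F, c F ≠ 0 → F ∈ Δ.faces ∧ (F.card : ℤ) = i + 1 := by
  rw [chains, Finsupp.mem_supported]
  exact ⟨fun h F hF => h (by simpa using hF), fun h F hF => h F (by simpa using hF)⟩

theorem single_mem_chains {Δ : FiniteComplex V} {F : Finset V} (hF : F ∈ Δ.faces) {i : ℤ}
    (hi : (F.card : ℤ) = i + 1) (a : k) : Finsupp.single F a ∈ Δ.chains k i :=
  Finsupp.single_mem_supported k a ⟨hF, hi⟩

theorem chains_mono {Γ Δ : FiniteComplex V} (h : Γ.faces ⊆ Δ.faces) (i : ℤ) :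
    Γ.chains k i ≤ Δ.chains k i := by
  intro c hc
  rw [mem_chains] at hc ⊢
  exact fun F hF => ⟨h (hc F hF).1, (hc F hF).2⟩

theorem eq_zero_of_mem_chains {Δ : FiniteComplex V} {i : ℤ} (hi : (Δ.rank : ℤ) - 1 < i)
    {c : Finset V →₀ k} (hc : c ∈ Δ.chains k i) : c = 0 := by
  ext F
  by_contra hF
  obtain ⟨h1, h2⟩ := mem_chains.1 hc F hF
  have := Δ.card_le_rank h1
  omega

end Faces

section Chains

variable {V : Type*} [LinearOrder V] (k : Type*) [Field k]

/-- The sign of the vertex `v` in the boundary of the simplex `F`. -/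
def incidence (v : V) (F : Finset V) : k := (-1) ^ (F.filter (fun w => w < v)).card

theorem incidence_ne_zero (v : V) (F : Finset V) : incidence k v F ≠ 0 :=
  pow_ne_zero _ (by simp)

/-- Deleting the smaller of two vertices lowers the position of the larger by one, while deleting
the larger does not affect the smaller. -/
theorem incidence_mul_incidence_erase {F : Finset V} {v w : V} (hv : v ∈ F) (hw : w ∈ F)
    (hvw : v ≠ w) :
    incidence k v F * incidence k w (F.erase v) = -(incidence k w F * incidence k v (F.erase w)) := by
  have key : ∀ v ∈ F, ∀ w ∈ F, v < w → incidence k v F * incidence k w (F.erase v) =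
      -(incidence k w F * incidence k v (F.erase w)) := by
    intro v hv w hw h
    unfold incidence
    have h1 : (F.erase w).filter (fun x => x < v) = F.filter (fun x => x < v) := by
      ext x; simp only [Finset.mem_filter, Finset.mem_erase]
      exact ⟨fun hx => ⟨hx.1.2, hx.2⟩, fun hx => ⟨⟨(hx.2.trans h).ne, hx.1⟩, hx.2⟩⟩
    have h2 : (F.erase v).filter (fun x => x < w) = (F.filter (fun x => x < w)).erase v := by
      rw [Finset.filter_erase]
    have h3 : (F.filter (fun x => x < w)).card
        = ((F.filter (fun x => x < w)).erase v).card + 1 :=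
      (Finset.card_erase_add_one (by simp [hv, h])).symm
    rw [h1, h2, h3]; ring
  rcases lt_or_gt_of_ne hvw with h | h
  · exact key v hv w hw h
  · rw [key w hw v hv h, neg_neg]

theorem boundary_single (F : Finset V) (a : k) :
    boundary k (Finsupp.single F a) =
      a • ∑ v ∈ F, incidence k v F • Finsupp.single (F.erase v) (1 : k) := by
  simp [boundary, incidence]

/-- Contraction by the vertex `v`: the simplices that contain `v` are replaced, with the sign of
the boundary operator, by their faces opposite to `v`. -/
noncomputable def contract (v : V) : (Finset V →₀ k) →ₗ[k] (Finset V →₀ k) :=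
  Finsupp.linearCombination k fun F : Finset V =>
    if v ∈ F then incidence k v F • Finsupp.single (F.erase v) (1 : k) else 0

theorem contract_single (v : V) (F : Finset V) (a : k) :
    contract k v (Finsupp.single F a) =
      if v ∈ F then a • incidence k v F • Finsupp.single (F.erase v) (1 : k) else 0 := by
  simp [contract]

theorem contract_apply (v : V) (c : Finset V →₀ k) (G : Finset V) :
    contract k v c G = if v ∈ G then 0 else incidence k v (insert v G) * c (insert v G) := by
  induction c using Finsupp.induction_linear with
  | zero => simp
  | add f g hf hg => 
    rw [map_add, Finsupp.add_apply, hf, hg, Finsupp.add_apply]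
    split_ifs <;> ring
  | single F a =>
    rw [contract_single]
    by_cases hG : v ∈ G
    · rw [if_pos hG]
      split_ifs with hF
      · have : F.erase v ≠ G := fun h => by simp [← h] at hG
        simp [this]
      · rfl
    · rw [if_neg hG]
      by_cases h : F = insert v G
      · subst h
        simp [Finset.erase_insert hG, mul_comm]
      · rw [Finsupp.single_eq_of_ne (Ne.symm h), mul_zero]
        split_ifs with hF
        · have : F.erase v ≠ G := fun h' => h (by rw [← h', Finset.insert_erase hF])
          simp [this]
        · rfl

theorem contract_contract (v w : V) (c : Finset V →₀ k) :
    contract k v (contract k w c) = - contract k w (contract k v c) := by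
  ext G
  rw [Finsupp.neg_apply]
  simp only [contract_apply]
  by_cases hvw : v = w
  · subst hvw; simp
  by_cases hv : v ∈ G
  · simp [hv]
  by_cases hw : w ∈ G
  · simp [hw]
  have h := incidence_mul_incidence_erase k (F := insert v (insert w G)) (v := v) (w := w)
    (by simp) (by simp) hvw
  have h1 : (insert v (insert w G)).erase v = insert w G := Finset.erase_insert (by simp [hvw, hv])
  have h2 : (insert v (insert w G)).erase w = insert v G := by
    rw [Finset.insert_comm]
    exact Finset.erase_insert (by simp [Ne.symm hvw, hw])
  rw [h1, h2] at h
  simp only [hv, hw, Finset.mem_insert, hvw, Ne.symm hvw, or_self, if_false]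
  rw [Finset.insert_comm w v]
  linear_combination (c (insert v (insert w G))) * h

/-- Both sides delete v and one further vertex, in opposite orders, so
`incidence_mul_incidence_erase` supplies the sign. Hence contraction carries cycles to cycles of the
link, which drives the inductions on rank below. -/
theorem contract_boundary (v : V) (c : Finset V →₀ k) :
    contract k v (boundary k c) = - boundary k (contract k v c) := by
  induction c using Finsupp.induction_linear with
  | zero => simp
  | add f g hf hg => simp only [map_add, hf, hg, neg_add]
  | single F a =>
    rw [boundary_single, contract_single]
    by_cases hv : v ∈ F
    · rw [if_pos hv]
      simp only [map_smul, map_sum, contract_single, boundary_single, one_smul, Finset.smul_sum,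
        ← Finset.sum_neg_distrib]
      rw [← Finset.add_sum_erase F _ hv, if_neg (by simp), smul_zero, smul_zero, zero_add]
      refine Finset.sum_congr rfl fun w hw => ?_
      obtain ⟨hwv, hw⟩ := Finset.mem_erase.1 hw
      rw [if_pos (Finset.mem_erase.2 ⟨hwv.symm, hv⟩), Finset.erase_right_comm,
        smul_smul (incidence k w F), smul_smul (incidence k v F),
        incidence_mul_incidence_erase k hw hv hwv, neg_smul, smul_neg]
    · rw [if_neg hv]
      simp only [map_smul, map_sum, contract_single, map_zero, neg_zero]
      refine smul_eq_zero_of_right _ (Finset.sum_eq_zero fun w hw => ?_)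
      rw [if_neg (fun h => hv (Finset.mem_of_mem_erase h)), smul_zero]

variable {k}

theorem mem_cycles {Δ : FiniteComplex V} {i : ℤ} {c : Finset V →₀ k} :
    c ∈ Δ.cycles k i ↔ c ∈ Δ.chains k i ∧ boundary k c = 0 := Iff.rfl

theorem mem_boundaries {Δ : FiniteComplex V} {i : ℤ} {c : Finset V →₀ k} :
    c ∈ Δ.boundaries k i ↔ ∃ b ∈ Δ.chains k (i + 1), boundary k b = c := Iff.rfl

theorem exists_of_boundary_apply_ne_zero {c : Finset V →₀ k} {G : Finset V}
    (h : boundary k c G ≠ 0) : ∃ F, c F ≠ 0 ∧ ∃ v ∈ F, G = F.erase v := by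
  by_contra! H
  apply h
  rw [← Finsupp.sum_single c, map_finsuppSum, Finsupp.sum, Finsupp.finsetSum_apply]
  refine Finset.sum_eq_zero fun F hF => ?_
  rw [boundary_single, Finsupp.smul_apply, Finsupp.finsetSum_apply]
  refine smul_eq_zero_of_right _ (Finset.sum_eq_zero fun v hv => ?_)
  rw [Finsupp.smul_apply, Finsupp.single_eq_of_ne, smul_zero]
  exact H F (by simpa using hF) v hv

theorem boundary_mem_chains {Δ : FiniteComplex V} {i j : ℤ} (hij : j + 1 = i) {c : Finset V →₀ k}
    (hc : c ∈ Δ.chains k i) : boundary k c ∈ Δ.chains k j := by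
  rw [mem_chains] at hc ⊢
  intro G hG
  obtain ⟨F, hF, v, hv, rfl⟩ := exists_of_boundary_apply_ne_zero hG
  refine ⟨Δ.down_closed (hc F hF).1 (Finset.erase_subset v F), ?_⟩
  have := Finset.card_erase_add_one hv
  have := (hc F hF).2
  omega

theorem cycles_mono {Γ Δ : FiniteComplex V} (h : Γ.faces ⊆ Δ.faces) (i : ℤ) :
    Γ.cycles k i ≤ Δ.cycles k i := fun _ hc => ⟨chains_mono h i hc.1, hc.2⟩

theorem contract_mem_chains {Δ : FiniteComplex V} {v : V} (hv : {v} ∈ Δ.faces) {i j : ℤ}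
    (hij : j + 1 = i) {c : Finset V →₀ k} (hc : c ∈ Δ.chains k i) :
    contract k v c ∈ (Δ.link {v} hv).chains k j := by
  rw [mem_chains] at hc ⊢
  intro G hG
  rw [contract_apply] at hG
  split_ifs at hG with h
  · exact absurd rfl hG
  · obtain ⟨h1, h2⟩ := hc _ (right_ne_zero_of_mul hG)
    refine ⟨mem_link_singleton.2 ⟨h, h1⟩, ?_⟩
    rw [Finset.card_insert_of_notMem h] at h2
    push_cast at h2
    omega

theorem contract_mem_cycles {Δ : FiniteComplex V} {v : V} (hv : {v} ∈ Δ.faces) {i j : ℤ}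
    (hij : j + 1 = i) {c : Finset V →₀ k} (hc : c ∈ Δ.cycles k i) :
    contract k v c ∈ (Δ.link {v} hv).cycles k j :=
  mem_cycles.2 ⟨contract_mem_chains hv hij hc.1, by
    rw [← neg_eq_zero, ← contract_boundary, (mem_cycles.1 hc).2, map_zero]⟩

theorem contract_apply_ne_zero {v : V} {c : Finset V →₀ k} {G : Finset V} :
    contract k v c G ≠ 0 ↔ v ∉ G ∧ c (insert v G) ≠ 0 := by
  rw [contract_apply]
  split_ifs with h
  · simp [h]
  · simp [h, incidence_ne_zero]

theorem subsingleton_reducedHomology {Δ : FiniteComplex V} {i : ℤ} :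
    Subsingleton (Δ.ReducedHomology k i) ↔ Δ.cycles k i ≤ Δ.boundaries k i := by
  rw [Submodule.Quotient.subsingleton_iff, Submodule.submoduleOf_eq_top]

variable (k) in
/-- The reduced homology of `Δ` in degree `i` is one-dimensional. -/
def HasLine (Δ : FiniteComplex V) (i : ℤ) : Prop :=
  ∃ z ∈ Δ.cycles k i, z ∉ Δ.boundaries k i ∧
    ∀ x ∈ Δ.cycles k i, ∃ a : k, x - a • z ∈ Δ.boundaries k i

/-- Replaces the quotient by statements about cycles: a line is spanned by the class of any
non-bounding cycle in it. -/
theorem nonempty_reducedHomology {Δ : FiniteComplex V} {i : ℤ} :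
    Nonempty (Δ.ReducedHomology k i ≃ₗ[k] k) ↔ Δ.HasLine k i := by
  have hmem : ∀ x : Δ.cycles k i, (Submodule.Quotient.mk x : Δ.ReducedHomology k i) = 0 ↔
      (x : Finset V →₀ k) ∈ Δ.boundaries k i := fun x => by
    rw [Submodule.Quotient.mk_eq_zero]; rfl
  constructor
  · rintro ⟨e⟩
    obtain ⟨z, hz⟩ := Submodule.Quotient.mk_surjective _ (e.symm 1)
    refine ⟨z, z.2, fun h => ?_, fun x hx => ⟨e (Submodule.Quotient.mk ⟨x, hx⟩), ?_⟩⟩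
    · rw [← hmem, hz] at h
      simp at h
    · refine (hmem (⟨x, hx⟩ - (e (Submodule.Quotient.mk ⟨x, hx⟩) : k) • z)).1 ?_
      rw [Submodule.Quotient.mk_sub, Submodule.Quotient.mk_smul, hz, ← map_smul, smul_eq_mul,
        mul_one, LinearEquiv.symm_apply_apply, sub_self]
  · rintro ⟨z, hz, h1, h2⟩
    have hf : Module.finrank k (Δ.ReducedHomology k i) = 1 := by
      refine finrank_eq_one (Submodule.Quotient.mk ⟨z, hz⟩) (fun h => h1 ((hmem _).1 h)) ?_
      intro w
      obtain ⟨⟨x, hx⟩, rfl⟩ := Submodule.Quotient.mk_surjective _ w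
      obtain ⟨a, ha⟩ := h2 x hx
      refine ⟨a, ?_⟩
      rw [← Submodule.Quotient.mk_smul, eq_comm, ← sub_eq_zero, ← Submodule.Quotient.mk_sub, hmem]
      exact ha
    have : Module.Finite k (Δ.ReducedHomology k i) := Module.finite_of_finrank_eq_succ hf
    exact ⟨LinearEquiv.ofFinrankEq _ _ (by rw [hf, Module.finrank_self])⟩

theorem single_sub_single_mem_cycles {Δ : FiniteComplex V} {u v : V} (hu : {u} ∈ Δ.faces)
    (hv : {v} ∈ Δ.faces) :
    Finsupp.single {u} 1 - Finsupp.single {v} 1 ∈ Δ.cycles k 0 := by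
  refine mem_cycles.2
    ⟨sub_mem (single_mem_chains hu (by simp) 1) (single_mem_chains hv (by simp) 1), ?_⟩
  rw [map_sub, boundary_single, boundary_single]
  simp [incidence, Finset.filter_singleton]

/-- A complex whose reduced homology vanishes in degree zero is connected. -/
theorem mem_of_adjacent_closed {Δ : FiniteComplex V} (h : Δ.cycles k 0 ≤ Δ.boundaries k 0)
    {S : Set V} (hS : ∀ u v, {u, v} ∈ Δ.faces → u ∈ S → v ∈ S) {u v : V} (hu : {u} ∈ Δ.faces)
    (hv : {v} ∈ Δ.faces) (huS : u ∈ S) : v ∈ S := by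
  classical
  by_contra hvS
  obtain ⟨y, hy, hyx⟩ := h (single_sub_single_mem_cycles (k := k) hu hv)
  -- φ sums the coefficients of the vertices in S. It kills boundaries of edges, as both ends of an
  -- edge lie on the same side of S, but it takes the value 1 on the bounding cycle {u} - {v}.
  let φ : (Finset V →₀ k) →ₗ[k] k :=
    Finsupp.linearCombination k fun F => if ∃ w ∈ S, F = {w} then 1 else 0
  have hφ : ∀ w, φ (Finsupp.single {w} 1) = if w ∈ S then 1 else 0 := by
    intro w
    simp only [φ, Finsupp.linearCombination_single, one_smul, Finset.singleton_inj]
    simp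
  have key : ∀ F ∈ Δ.faces, F.card = 2 → φ (boundary k (Finsupp.single F 1)) = 0 := by
    intro F hF h2
    obtain ⟨a, b, hab, rfl⟩ := Finset.card_eq_two.1 h2
    have e : ({a, b} : Finset V).erase a = {b} := by
      rw [Finset.erase_insert (by simpa using hab)]
    have e' : ({a, b} : Finset V).erase b = {a} := by
      rw [Finset.pair_comm, Finset.erase_insert (by simpa using hab.symm)]
    have hs := incidence_mul_incidence_erase k (F := {a, b}) (v := a) (w := b) (by simp) (by simp)
      hab
    rw [e, e'] at hs
    have hone : ∀ x : V, incidence k x {x} = 1 := fun x => by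
      simp [incidence, Finset.filter_singleton]
    rw [hone, hone, mul_one, mul_one] at hs
    have hiff : a ∈ S ↔ b ∈ S := ⟨hS a b hF, hS b a (by rwa [Finset.pair_comm])⟩
    rw [boundary_single, one_smul, Finset.sum_pair hab, e, e', map_add, map_smul, map_smul, hφ, hφ,
      hs]
    by_cases ha : a ∈ S <;> simp [ha, ← hiff]
  have : φ (boundary k y) = 0 := by
    rw [← Finsupp.sum_single y, map_finsuppSum, map_finsuppSum, Finsupp.sum]
    refine Finset.sum_eq_zero fun F hF => ?_
    obtain ⟨h1, h2⟩ := mem_chains.1 hy F (by simpa using hF)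
    have := key F h1 (by omega)
    rw [← mul_one (y F), ← smul_eq_mul, ← Finsupp.smul_single, map_smul, map_smul, this, smul_zero]
  rw [hyx, map_sub, hφ, hφ, if_pos huS, if_neg hvS] at this
  simp at this

end Chains

end FiniteComplex

namespace FiniteComplex

/-! ### Homology spheres: purity and the fundamental cycle -/

section Spheres

variable {V : Type*} [LinearOrder V] {k : Type*} [Field k]

theorem isHomologySphere_iff {Δ : FiniteComplex V} :
    Δ.IsHomologySphere k ↔ ∀ (F : Finset V) (hF : F ∈ Δ.faces),
      (Δ.link F hF).HasLine k (Δ.link F hF).dim ∧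
      ∀ i ≠ (Δ.link F hF).dim, (Δ.link F hF).cycles k i ≤ (Δ.link F hF).boundaries k i := by
  simp only [IsHomologySphere, nonempty_reducedHomology, subsingleton_reducedHomology]
  refine forall₂_congr fun F hF => ⟨fun h => ⟨(h _).1 rfl, fun i => (h i).2⟩, fun h i => ⟨?_, h.2 i⟩⟩
  rintro rfl
  exact h.1

theorem IsHomologySphere.hasLine {Δ : FiniteComplex V} (h : Δ.IsHomologySphere k) :
    Δ.HasLine k Δ.dim := by
  simpa only [link_empty] using (isHomologySphere_iff.1 h ∅ Δ.empty_mem).1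

theorem IsHomologySphere.cycles_le_boundaries {Δ : FiniteComplex V} (h : Δ.IsHomologySphere k)
    {i : ℤ} (hi : i ≠ Δ.dim) : Δ.cycles k i ≤ Δ.boundaries k i := by
  have := (isHomologySphere_iff.1 h ∅ Δ.empty_mem).2 i
  simp only [link_empty] at this
  exact this hi

theorem IsHomologySphere.link {Δ : FiniteComplex V} (h : Δ.IsHomologySphere k) {F : Finset V}
    (hF : F ∈ Δ.faces) : (Δ.link F hF).IsHomologySphere k := by
  rw [isHomologySphere_iff] at h ⊢
  intro G hG
  rw [link_link]
  exact h _ _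

theorem link_singleton_link_singleton {Δ : FiniteComplex V} {u v : V} (hu : {u} ∈ Δ.faces)
    (hv : {v} ∈ (Δ.link {u} hu).faces) (huv : {u, v} ∈ Δ.faces) :
    (Δ.link {u} hu).link {v} hv = Δ.link {u, v} huv := link_link _ _ _

theorem singleton_mem_link_singleton {Δ : FiniteComplex V} {u v : V} {hu : {u} ∈ Δ.faces} :
    {v} ∈ (Δ.link {u} hu).faces ↔ u ≠ v ∧ {u, v} ∈ Δ.faces := by
  rw [mem_link_singleton, Finset.mem_singleton]

/-- Connectedness forces purity. A vertex of a largest face has a link of the right rank. The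
property passes along an edge, since by induction the rank of the link of the edge is determined
from the link of either end. In rank at least 2 the complex is connected, so every vertex is
reached. -/
theorem IsHomologySphere.rank_link_singleton {Δ : FiniteComplex V} (h : Δ.IsHomologySphere k)
    {v : V} (hv : {v} ∈ Δ.faces) : (Δ.link {v} hv).rank + 1 = Δ.rank := by
  obtain ⟨N, hN⟩ : ∃ N, N = Δ.rank := ⟨_, rfl⟩
  induction N using Nat.strong_induction_on generalizing Δ v with
  | _ N ih =>
  have hle := Δ.rank_link_add_card_le hv
  rw [Finset.card_singleton] at hle
  by_cases h1 : Δ.rank = 1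
  · omega
  obtain ⟨F, hF, hFc⟩ := Δ.exists_card_eq_rank
  obtain ⟨u, huF⟩ : F.Nonempty := by
    rw [← Finset.card_pos]; omega
  have hu : {u} ∈ Δ.faces := Δ.down_closed hF (by simpa using huF)
  have h0 : Δ.cycles k 0 ≤ Δ.boundaries k 0 := h.cycles_le_boundaries (by unfold dim; omega)
  let S : Set V := {w | ∃ hw : {w} ∈ Δ.faces, (Δ.link {w} hw).rank + 1 = Δ.rank}
  have huS : u ∈ S := by
    refine ⟨hu, ?_⟩
    have h2 := Δ.rank_link_add_card_le hu
    rw [Finset.card_singleton] at h2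
    have h3 : F.erase u ∈ (Δ.link {u} hu).faces := by
      rw [mem_link_singleton, Finset.insert_erase huF]
      exact ⟨by simp, hF⟩
    have := (Δ.link {u} hu).card_le_rank h3
    have := Finset.card_erase_add_one huF
    omega
  obtain ⟨_, hvS⟩ : v ∈ S := by
    refine mem_of_adjacent_closed h0 ?_ hu hv huS
    rintro a b hab ⟨ha, har⟩
    rcases eq_or_ne a b with rfl | hne
    · exact ⟨ha, har⟩
    have hb : {b} ∈ Δ.faces := Δ.down_closed hab (by simp)
    have hba : ({b, a} : Finset V) ∈ Δ.faces := by rwa [Finset.pair_comm]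
    have hb' := singleton_mem_link_singleton (hu := ha).2 ⟨hne, hab⟩
    have ha' := singleton_mem_link_singleton (hu := hb).2 ⟨hne.symm, hba⟩
    have hble := Δ.rank_link_add_card_le hb
    rw [Finset.card_singleton] at hble
    have e1 := ih _ (by omega) (h.link ha) hb' rfl
    have e2 := ih _ (by omega) (h.link hb) ha' rfl
    rw [link_singleton_link_singleton _ _ hab] at e1
    rw [link_singleton_link_singleton _ _ hba, link_congr _ (Finset.pair_comm b a) hba hab] at e2
    exact ⟨hb, by omega⟩
  exact hvS

theorem IsHomologySphere.exists_facet {Δ : FiniteComplex V} (h : Δ.IsHomologySphere k)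
    {F : Finset V} (hF : F ∈ Δ.faces) : ∃ G ∈ Δ.faces, F ⊆ G ∧ G.card = Δ.rank := by
  induction F using Finset.induction_on generalizing Δ with
  | empty =>
    obtain ⟨G, hG, h⟩ := Δ.exists_card_eq_rank
    exact ⟨G, hG, Finset.empty_subset _, h⟩
  | insert v F hv ih =>
    have hv' : {v} ∈ Δ.faces := Δ.down_closed hF (by simp)
    obtain ⟨G, hG, hFG, hc⟩ := ih (h.link hv') (mem_link_singleton.2 ⟨hv, hF⟩)
    obtain ⟨h1, h2⟩ := mem_link_singleton.1 hG
    refine ⟨_, h2, Finset.insert_subset_insert v hFG, ?_⟩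
    rw [Finset.card_insert_of_notMem h1, hc, h.rank_link_singleton hv']

theorem IsHomologySphere.rank_link {Δ : FiniteComplex V} (h : Δ.IsHomologySphere k)
    {F : Finset V} (hF : F ∈ Δ.faces) : (Δ.link F hF).rank + F.card = Δ.rank := by
  refine le_antisymm (Δ.rank_link_add_card_le hF) ?_
  obtain ⟨G, hG, hFG, hc⟩ := h.exists_facet hF
  have : G \ F ∈ (Δ.link F hF).faces := by
    rw [mem_link, Finset.union_sdiff_of_subset hFG]
    exact ⟨Finset.disjoint_sdiff, hG⟩
  have := (Δ.link F hF).card_le_rank this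
  have := Finset.card_sdiff_add_card_eq_card hFG
  omega

theorem eq_zero_of_mem_boundaries {Δ : FiniteComplex V} {i : ℤ} (hi : Δ.dim ≤ i)
    {c : Finset V →₀ k} (hc : c ∈ Δ.boundaries k i) : c = 0 := by
  obtain ⟨b, hb, rfl⟩ := hc
  rw [eq_zero_of_mem_chains (by unfold dim at hi; omega) hb, map_zero]

/-- In top degree there are no nonzero boundaries, so the homology line is the space of cycles
itself. -/
theorem IsHomologySphere.exists_fundamental {Δ : FiniteComplex V} (h : Δ.IsHomologySphere k) :
    ∃ z ∈ Δ.cycles k Δ.dim, z ≠ 0 ∧ ∀ x ∈ Δ.cycles k Δ.dim, ∃ a : k, x = a • z := by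
  obtain ⟨z, hz, h1, h2⟩ := h.hasLine
  refine ⟨z, hz, fun h0 => h1 (h0 ▸ zero_mem _), fun x hx => ?_⟩
  obtain ⟨a, ha⟩ := h2 x hx
  exact ⟨a, sub_eq_zero.1 (eq_zero_of_mem_boundaries le_rfl ha)⟩

theorem IsHomologySphere.exists_smul_eq {Δ : FiniteComplex V} (h : Δ.IsHomologySphere k)
    {z x : Finset V →₀ k} (hz : z ∈ Δ.cycles k Δ.dim) (hz0 : z ≠ 0) (hx : x ∈ Δ.cycles k Δ.dim) :
    ∃ a : k, x = a • z := by
  obtain ⟨y, -, hy0, hy⟩ := h.exists_fundamental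
  obtain ⟨a, rfl⟩ := hy z hz
  obtain ⟨b, rfl⟩ := hy x hx
  have ha : a ≠ 0 := fun h => hz0 (by rw [h, zero_smul])
  exact ⟨b / a, by rw [smul_smul, div_mul_cancel₀ b ha]⟩

/-- A nonzero top-dimensional cycle of a homology sphere is supported on all facets. -/
theorem IsHomologySphere.apply_ne_zero {Δ : FiniteComplex V} (h : Δ.IsHomologySphere k)
    {z : Finset V →₀ k} (hz : z ∈ Δ.cycles k Δ.dim) (hz0 : z ≠ 0) {F : Finset V}
    (hF : F ∈ Δ.faces) (hFc : F.card = Δ.rank) : z F ≠ 0 := by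
  obtain ⟨N, hN⟩ : ∃ N, N = Δ.rank := ⟨_, rfl⟩
  induction N using Nat.strong_induction_on generalizing Δ z F with
  | _ N ih =>
  obtain ⟨G, hG : z G ≠ 0⟩ := Finsupp.ne_iff.1 hz0
  obtain ⟨hGΔ, hGc⟩ := mem_chains.1 hz.1 G hG
  have hGc' : G.card = Δ.rank := by unfold dim at hGc; omega
  by_cases hr0 : Δ.rank = 0
  · have : F = G := by
      rw [Finset.card_eq_zero.1 (hFc.trans hr0), Finset.card_eq_zero.1 (hGc'.trans hr0)]
    rwa [this]
  by_cases hr1 : Δ.rank = 1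
  · obtain ⟨p, rfl⟩ := Finset.card_eq_one.1 (hFc.trans hr1)
    obtain ⟨q, rfl⟩ := Finset.card_eq_one.1 (hGc'.trans hr1)
    intro hp
    have hd : Δ.dim = 0 := by unfold dim; omega
    -- If z vanished at p but not at q, the cycle {p} - {q} would not be a multiple of z.
    obtain ⟨a, ha⟩ := h.exists_smul_eq hz hz0
      (hd ▸ single_sub_single_mem_cycles (k := k) hF hGΔ)
    have hpq : ({p} : Finset V) ≠ {q} := fun e => hG (e ▸ hp)
    have := DFunLike.congr_fun ha {p}
    rw [Finsupp.smul_apply, hp, Finsupp.sub_apply, Finsupp.single_eq_same,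
      Finsupp.single_eq_of_ne hpq] at this
    simp at this
  have h0 : Δ.cycles k 0 ≤ Δ.boundaries k 0 := h.cycles_le_boundaries (by unfold dim; omega)
  obtain ⟨u, huG⟩ : G.Nonempty := by
    rw [← Finset.card_pos]; omega
  obtain ⟨v, hvF⟩ : F.Nonempty := by
    rw [← Finset.card_pos]; omega
  have hu : {u} ∈ Δ.faces := Δ.down_closed hGΔ (by simpa using huG)
  have hv : {v} ∈ Δ.faces := Δ.down_closed hF (by simpa using hvF)
  have hfull : ∀ (w : V) (hw : {w} ∈ Δ.faces), contract k w z ≠ 0 →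
      ∀ H ∈ (Δ.link {w} hw).faces, H.card = (Δ.link {w} hw).rank → contract k w z H ≠ 0 := by
    intro w hw hne H hH hHc
    have := h.rank_link_singleton hw
    exact ih _ (by omega) (h.link hw) (contract_mem_cycles hw (by unfold dim; omega) hz) hne hH hHc
      rfl
  -- At a vertex of S the contraction of z is nonzero on every facet of the link, by induction. A
  -- facet of that link through a neighbour b then shows b ∈ S, and connectedness puts all vertices
  -- in S.
  let S : Set V := {w | contract k w z ≠ 0}
  have huS : u ∈ S := by
    intro h0
    have : contract k u z (G.erase u) ≠ 0 := by
      rw [contract_apply_ne_zero, Finset.insert_erase huG]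
      exact ⟨by simp, hG⟩
    rw [h0] at this
    exact this rfl
  have hvS : v ∈ S := by
    refine mem_of_adjacent_closed h0 ?_ hu hv huS
    intro a b hab haS
    rcases eq_or_ne a b with rfl | hne
    · exact haS
    have ha : {a} ∈ Δ.faces := Δ.down_closed hab (by simp)
    have hb' := singleton_mem_link_singleton (hu := ha).2 ⟨hne, hab⟩
    obtain ⟨H, hH, hbH, hHc⟩ := (h.link ha).exists_facet hb'
    have h1 := hfull a ha haS H hH hHc
    obtain ⟨haH, h2⟩ := contract_apply_ne_zero.1 h1
    have hbH' : b ∈ insert a H := Finset.mem_insert_of_mem (by simpa using hbH)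
    intro h3
    have : contract k b z ((insert a H).erase b) ≠ 0 := by
      rw [contract_apply_ne_zero, Finset.insert_erase hbH']
      exact ⟨by simp, h2⟩
    rw [h3] at this
    exact this rfl
  have h3 : F.erase v ∈ (Δ.link {v} hv).faces := by
    rw [mem_link_singleton, Finset.insert_erase hvF]
    exact ⟨by simp, hF⟩
  have h4 := h.rank_link_singleton hv
  have h5 := Finset.card_erase_add_one hvF
  have := (contract_apply_ne_zero.1 (hfull v hv hvS _ h3 (by omega))).2
  rwa [Finset.insert_erase hvF] at this

end Spheres

end FiniteComplex

namespace FiniteComplex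

/-! ### Decompositions of a sphere along a codimension-one sphere -/

section Restrict

variable {V : Type*}

open Classical in
/-- The subcomplex of `Δ` induced on the set `S`. -/
noncomputable def restrict (Δ : FiniteComplex V) (S : Set V) : FiniteComplex V where
  faces := Δ.faces.filter (fun F => ∀ v ∈ F, v ∈ S)
  empty_mem := by simp [Δ.empty_mem]
  down_closed := by
    intro F G hG hFG
    simp only [Finset.mem_filter] at hG ⊢
    exact ⟨Δ.down_closed hG.1 hFG, fun v hv => hG.2 v (hFG hv)⟩

theorem mem_restrict {Δ : FiniteComplex V} {S : Set V} {F : Finset V} :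
    F ∈ (Δ.restrict S).faces ↔ F ∈ Δ.faces ∧ ∀ v ∈ F, v ∈ S := by
  classical
  simp [restrict]

theorem IsFlag.restrict [DecidableEq V] {Δ : FiniteComplex V} (h : Δ.IsFlag) (S : Set V) :
    (Δ.restrict S).IsFlag := by
  intro F hF
  rw [mem_restrict]
  exact ⟨h F fun u hu v hv => (mem_restrict.1 (hF u hu v hv)).1,
    fun v hv => (mem_restrict.1 (hF v hv v hv)).2 v (by simp)⟩

end Restrict

theorem apply_eq_zero_of_notMem {V k : Type*} [Field k] {Δ : FiniteComplex V} {i : ℤ}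
    {c : Finset V →₀ k} (hc : c ∈ Δ.chains k i) {F : Finset V} (hF : F ∉ Δ.faces) : c F = 0 := by
  by_contra h
  exact hF (mem_chains.1 hc F h).1


section Decomposition

variable {V : Type*} [DecidableEq V]

/-- `L` is the union of its subcomplexes `L₁` and `L₂`, which intersect in `M` and neither of which
contains the other. -/
structure IsDecomposition (L L₁ L₂ M : FiniteComplex V) : Prop where
  union : L.faces = L₁.faces ∪ L₂.faces
  inter : M.faces = L₁.faces ∩ L₂.faces
  left : ∃ F ∈ L₁.faces, F ∉ L₂.faces
  right : ∃ F ∈ L₂.faces, F ∉ L₁.faces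

namespace IsDecomposition

variable {L L₁ L₂ M : FiniteComplex V}

theorem symm (h : IsDecomposition L L₁ L₂ M) : IsDecomposition L L₂ L₁ M :=
  ⟨by rw [h.union, Finset.union_comm], by rw [h.inter, Finset.inter_comm], h.right, h.left⟩

theorem left_subset (h : IsDecomposition L L₁ L₂ M) : L₁.faces ⊆ L.faces := by
  rw [h.union]; exact Finset.subset_union_left

theorem right_subset (h : IsDecomposition L L₁ L₂ M) : L₂.faces ⊆ L.faces := h.symm.left_subset

theorem inter_subset_left (h : IsDecomposition L L₁ L₂ M) : M.faces ⊆ L₁.faces := by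
  rw [h.inter]; exact Finset.inter_subset_left

theorem inter_subset_right (h : IsDecomposition L L₁ L₂ M) : M.faces ⊆ L₂.faces :=
  h.symm.inter_subset_left

theorem mem_or_mem (h : IsDecomposition L L₁ L₂ M) {F : Finset V} (hF : F ∈ L.faces) :
    F ∈ L₁.faces ∨ F ∈ L₂.faces := by
  rwa [h.union, Finset.mem_union] at hF

theorem mem_inter (h : IsDecomposition L L₁ L₂ M) {F : Finset V} (h1 : F ∈ L₁.faces)
    (h2 : F ∈ L₂.faces) : F ∈ M.faces := by
  rw [h.inter]; exact Finset.mem_inter.2 ⟨h1, h2⟩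

theorem mem_left_of_subset (h : IsDecomposition L L₁ L₂ M) {F G : Finset V} (hG : G ∈ L.faces)
    (hFG : F ⊆ G) (hF : F ∉ L₂.faces) : G ∈ L₁.faces ∧ G ∉ L₂.faces :=
  have h2 : G ∉ L₂.faces := fun h2 => hF (L₂.down_closed h2 hFG)
  ⟨(h.mem_or_mem hG).resolve_right h2, h2⟩

theorem link_eq (h : IsDecomposition L L₁ L₂ M) {F : Finset V} (hF : F ∈ L₁.faces)
    (hFM : F ∉ M.faces) : L₁.link F hF = L.link F (h.left_subset hF) := by
  ext G
  rw [mem_link, mem_link]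
  refine and_congr_right fun _ => ⟨fun h1 => h.left_subset h1, fun h1 => ?_⟩
  exact (h.mem_left_of_subset h1 Finset.subset_union_left fun h2 => hFM (h.mem_inter hF h2)).1

end IsDecomposition

end Decomposition

namespace IsDecomposition

variable {V : Type*} [LinearOrder V] {k : Type*} [Field k] {L L₁ L₂ M : FiniteComplex V}

theorem exists_split (h : IsDecomposition L L₁ L₂ M) {i : ℤ} {y : Finset V →₀ k}
    (hy : y ∈ L.chains k i) :
    ∃ y₁ ∈ L₁.chains k i, ∃ y₂ ∈ L₂.chains k i, y = y₁ + y₂ := by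
  classical
  rw [mem_chains] at hy
  refine ⟨y.filter (· ∈ L₁.faces), mem_chains.2 fun F hF => ?_,
    y.filter (fun F => ¬ F ∈ L₁.faces), mem_chains.2 fun F hF => ?_,
    (Finsupp.filter_add_filter_not y _).symm⟩
  · obtain ⟨h2, h1⟩ := Finset.mem_filter.1 (Finsupp.support_filter (· ∈ L₁.faces) y ▸
      Finsupp.mem_support_iff.2 hF)
    exact ⟨h1, (hy F (Finsupp.mem_support_iff.1 h2)).2⟩
  · obtain ⟨h2, h1⟩ := Finset.mem_filter.1 (Finsupp.support_filter (fun F => ¬ F ∈ L₁.faces) y ▸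
      Finsupp.mem_support_iff.2 hF)
    have := hy F (Finsupp.mem_support_iff.1 h2)
    exact ⟨(h.mem_or_mem this.1).resolve_left h1, this.2⟩

theorem mem_chains_inter (h : IsDecomposition L L₁ L₂ M) {i : ℤ} {y : Finset V →₀ k}
    (h1 : y ∈ L₁.chains k i) (h2 : y ∈ L₂.chains k i) : y ∈ M.chains k i := by
  rw [mem_chains] at h1 h2 ⊢
  exact fun F hF => ⟨h.mem_inter (h1 F hF).1 (h2 F hF).1, (h1 F hF).2⟩

theorem exists_facet_left (h : IsDecomposition L L₁ L₂ M) (hL : L.IsHomologySphere k) :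
    ∃ G ∈ L₁.faces, G ∉ L₂.faces ∧ G.card = L.rank := by
  obtain ⟨F, hF1, hF2⟩ := h.left
  obtain ⟨G, hG, hFG, hc⟩ := hL.exists_facet (h.left_subset hF1)
  obtain ⟨h1, h2⟩ := h.mem_left_of_subset hG hFG hF2
  exact ⟨G, h1, h2, hc⟩

/-- Split the fundamental cycle as z = y₁ + y₂. Then ∂y₁ = -∂y₂ is carried by both sides, hence by
M. If it vanished, y₁ would be a multiple of z; as y₁ is zero on a facet outside L₁, the multiple
would be 0, and then z would vanish on a facet outside L₂. -/
theorem exists_bounding_chain (h : IsDecomposition L L₁ L₂ M) (hL : L.IsHomologySphere k)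
    (hr : M.rank + 1 = L.rank) :
    ∃ y ∈ L₁.chains k L.dim, boundary k y ∈ M.cycles k M.dim ∧ boundary k y ≠ 0 := by
  obtain ⟨z, hz, hz0, -⟩ := hL.exists_fundamental
  obtain ⟨y₁, h1, y₂, h2, rfl⟩ := h.exists_split hz.1
  have hd : M.dim + 1 = L.dim := by unfold dim; omega
  have hb : boundary k y₁ = - boundary k y₂ :=
    eq_neg_of_add_eq_zero_left (by rw [← map_add]; exact hz.2)
  refine ⟨y₁, h1, mem_cycles.2 ⟨h.mem_chains_inter (boundary_mem_chains hd h1) ?_,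
    boundary_boundary k _⟩, fun h0 => ?_⟩
  · rw [hb]
    exact neg_mem (boundary_mem_chains hd h2)
  · have hy1 : y₁ ∈ L.cycles k L.dim := mem_cycles.2 ⟨chains_mono h.left_subset _ h1, h0⟩
    obtain ⟨a, ha⟩ := hL.exists_smul_eq hz hz0 hy1
    obtain ⟨G, hG1, hG2, hGc⟩ := h.exists_facet_left hL
    obtain ⟨H, hH2, hH1, hHc⟩ := h.symm.exists_facet_left hL
    have e1 := DFunLike.congr_fun ha G
    have e2 := DFunLike.congr_fun ha H
    have hzG := hL.apply_ne_zero hz hz0 (h.left_subset hG1) hGc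
    have hzH := hL.apply_ne_zero hz hz0 (h.right_subset hH2) hHc
    rw [apply_eq_zero_of_notMem h1 hH1, Finsupp.smul_apply, smul_eq_mul, eq_comm,
      mul_eq_zero] at e2
    rw [Finsupp.smul_apply, e2.resolve_right hzH, zero_smul] at e1
    rw [Finsupp.add_apply, e1, apply_eq_zero_of_notMem h2 hG2, add_zero] at hzG
    exact hzG rfl

/-- Every face of a homology sphere of codimension one that separates a homology sphere is contained
in faces on each side. -/
theorem exists_superset (h : IsDecomposition L L₁ L₂ M) (hL : L.IsHomologySphere k)
    (hM : M.IsHomologySphere k) (hr : M.rank + 1 = L.rank) {F : Finset V} (hF : F ∈ M.faces) :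
    ∃ G ∈ L₁.faces, G ∉ L₂.faces ∧ F ⊆ G := by
  obtain ⟨y, hy, h1, h2⟩ := h.exists_bounding_chain hL hr
  obtain ⟨R, hR, hFR, hRc⟩ := hM.exists_facet hF
  -- ∂y is nonzero on the facet R of M, so R lies in a face H of L₁ in the support of y. That face
  -- is too large to belong to M, hence is not in L₂.
  obtain ⟨H, hH, v, hv, rfl⟩ := exists_of_boundary_apply_ne_zero (hM.apply_ne_zero h1 h2 hR hRc)
  obtain ⟨hH1, hHc⟩ := mem_chains.1 hy H hH
  refine ⟨H, hH1, fun hH2 => ?_, hFR.trans (Finset.erase_subset _ _)⟩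
  have := M.card_le_rank (h.mem_inter hH1 hH2)
  unfold dim at hHc
  omega

/-- Union and intersection pass to links formally; that neither side swallows the other near F is
`exists_superset`. -/
theorem link (h : IsDecomposition L L₁ L₂ M) (hL : L.IsHomologySphere k)
    (hM : M.IsHomologySphere k) (hr : M.rank + 1 = L.rank) {F : Finset V} (hF : F ∈ M.faces) :
    IsDecomposition (L.link F (h.left_subset (h.inter_subset_left hF)))
      (L₁.link F (h.inter_subset_left hF)) (L₂.link F (h.inter_subset_right hF)) (M.link F hF) where
  union := by
    ext G
    simp only [Finset.mem_union, mem_link, h.union, ← and_or_left]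
  inter := by
    ext G
    simp only [Finset.mem_inter, mem_link, h.inter]
    tauto
  left := by
    obtain ⟨G, h1, h2, hFG⟩ := h.exists_superset hL hM hr hF
    refine ⟨G \ F, ?_, ?_⟩ <;> rw [mem_link, Finset.union_sdiff_of_subset hFG]
    · exact ⟨Finset.disjoint_sdiff, h1⟩
    · exact fun h => h2 h.2
  right := by
    obtain ⟨G, h1, h2, hFG⟩ := h.symm.exists_superset hL hM hr hF
    refine ⟨G \ F, ?_, ?_⟩ <;> rw [mem_link, Finset.union_sdiff_of_subset hFG]
    · exact ⟨Finset.disjoint_sdiff, h1⟩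
    · exact fun h => h2 h.2

/-- Mayer–Vietoris on chains. In the top degree of L, a cycle of L₁ is a multiple of the fundamental
cycle that vanishes outside L₁, so it is zero. Otherwise it bounds some y₁ + y₂ in L, and ∂y₂ is a
cycle of M. This bounds in M, except in the top degree of M, where it is a multiple of the boundary
of the chain of L₁ from `exists_bounding_chain`. -/
theorem cycles_le_boundaries_left (h : IsDecomposition L L₁ L₂ M) (hL : L.IsHomologySphere k)
    (hM : M.IsHomologySphere k) (hr : M.rank + 1 = L.rank) (i : ℤ) :
    L₁.cycles k i ≤ L₁.boundaries k i := by
  intro x hx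
  have hxL := cycles_mono h.left_subset i hx
  have hd : M.dim + 1 = L.dim := by unfold dim; omega
  rcases eq_or_ne i L.dim with rfl | hi
  · obtain ⟨z, hz, hz0, hz1⟩ := hL.exists_fundamental
    obtain ⟨a, rfl⟩ := hz1 x hxL
    obtain ⟨H, hH2, hH1, hHc⟩ := h.symm.exists_facet_left hL
    have hzH := hL.apply_ne_zero hz hz0 (h.right_subset hH2) hHc
    have := apply_eq_zero_of_notMem hx.1 hH1
    rw [Finsupp.smul_apply, smul_eq_mul, mul_eq_zero] at this
    rw [this.resolve_right hzH, zero_smul]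
    exact zero_mem _
  obtain ⟨y, hy, hyx⟩ := hL.cycles_le_boundaries hi hxL
  obtain ⟨y₁, h1, y₂, h2, rfl⟩ := h.exists_split hy
  suffices H : boundary k y₂ ∈ L₁.boundaries k i by
    rw [← hyx, map_add]
    exact add_mem ⟨y₁, h1, rfl⟩ H
  have hcyc : boundary k y₂ ∈ M.cycles k i := by
    refine mem_cycles.2 ⟨h.mem_chains_inter ?_ (boundary_mem_chains rfl h2), boundary_boundary k _⟩
    have : boundary k y₂ = x - boundary k y₁ := by rw [← hyx, map_add, add_sub_cancel_left]
    rw [this]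
    exact sub_mem hx.1 (boundary_mem_chains rfl h1)
  rcases eq_or_ne i M.dim with rfl | hi'
  · obtain ⟨w, hw, hw1, hw2⟩ := h.exists_bounding_chain hL hr
    obtain ⟨a, ha⟩ := hM.exists_smul_eq hw1 hw2 hcyc
    rw [ha, ← map_smul]
    exact ⟨a • w, Submodule.smul_mem _ _ (hd ▸ hw), rfl⟩
  · obtain ⟨m, hm, hmy⟩ := hM.cycles_le_boundaries hi' hcyc
    exact ⟨m, chains_mono h.inter_subset_left _ hm, hmy⟩

/-- A homology sphere of codimension one that separates a homology sphere bounds homology balls. -/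
theorem isHomologyBall_left (h : IsDecomposition L L₁ L₂ M) (hL : L.IsHomologySphere k)
    (hM : M.IsHomologySphere k) (hr : M.rank + 1 = L.rank) :
    L₁.rank = L.rank ∧ L₁.IsHomologyBall k M := by
  have hr1 : L₁.rank = L.rank := by
    obtain ⟨G, hG1, -, hGc⟩ := h.exists_facet_left hL
    exact rank_eq_of_forall (fun F hF => L.card_le_rank (h.left_subset hF)) hG1 hGc
  refine ⟨hr1, h.inter_subset_left, hM, by unfold dim; omega, fun F hF i => ⟨?_, ?_⟩⟩
  · rintro ⟨hFM, rfl⟩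
    rw [h.link_eq hF hFM]
    exact (hL F _ _).1 rfl
  · intro hi
    by_cases hFM : F ∈ M.faces
    -- The link of a boundary face is one side of the decomposition of its link in L, hence acyclic.
    · rw [subsingleton_reducedHomology]
      refine (h.link hL hM hr hFM).cycles_le_boundaries_left (hL.link _) (hM.link hFM) ?_ i
      have := hL.rank_link (h.left_subset (h.inter_subset_left hFM))
      have := hM.rank_link hFM
      omega
    · rw [h.link_eq hF hFM] at hi ⊢
      exact (hL F _ _).2 fun h => hi ⟨hFM, h⟩

end IsDecomposition

/-! ### Jordan separation -/

section Separation

variable {V : Type*} [LinearOrder V] {k : Type*} [Field k] {Δ Γ : FiniteComplex V}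

theorem IsInducedSubcomplex.exists_notMem {V : Type*} {Δ Γ : FiniteComplex V}
    (hΓΔ : Γ.IsInducedSubcomplex Δ) {F : Finset V} (hF : F ∈ Δ.faces) (hc : Γ.rank < F.card) :
    ∃ v ∈ F, {v} ∉ Γ.faces := by
  by_contra! H
  have := Γ.card_le_rank (hΓΔ.2 F hF H)
  omega

/-- The Jordan separation theorem for an induced homology sphere of codimension one. -/
theorem IsInducedSubcomplex.exists_isDecomposition (hΔ : Δ.IsHomologySphere k)
    (hΓ : Γ.IsHomologySphere k) (hr : Γ.rank + 1 = Δ.rank) (hΓΔ : Γ.IsInducedSubcomplex Δ) :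
    ∃ S₁ S₂ : Set V, IsDecomposition Δ (Δ.restrict S₁) (Δ.restrict S₂) Γ := by
  obtain ⟨z, hz, hz0, -⟩ := hΔ.exists_fundamental
  obtain ⟨ω, hω, hω0, -⟩ := hΓ.exists_fundamental
  have hd : Γ.dim + 1 = Δ.dim := by unfold dim; omega
  -- ω has degree one below the top, so it bounds in Δ. The sides of Γ are recovered by comparing c
  -- with z around each vertex outside Γ.
  obtain ⟨c, hc, hcω⟩ := hΔ.cycles_le_boundaries (by omega) (cycles_mono hΓΔ.1 _ hω)
  rw [hd] at hc
  -- a vertex outside `Γ` sees `c` as a multiple of the fundamental cycle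
  have hex : ∀ v, {v} ∈ Δ.faces → {v} ∉ Γ.faces → ∃ a : k, contract k v c = a • contract k v z := by
    intro v hv hvΓ
    have hl := hΔ.rank_link_singleton hv
    have hld : (Δ.link {v} hv).dim + 1 = Δ.dim := by unfold dim; omega
    refine (hΔ.link hv).exists_smul_eq (contract_mem_cycles hv hld hz) ?_
      (mem_cycles.2 ⟨contract_mem_chains hv hld hc, ?_⟩)
    · obtain ⟨G, hG, hvG, hGc⟩ := hΔ.exists_facet hv
      rw [Finset.singleton_subset_iff] at hvG
      intro h0
      have : contract k v z (G.erase v) ≠ 0 := by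
        rw [contract_apply_ne_zero, Finset.insert_erase hvG]
        exact ⟨by simp, hΔ.apply_ne_zero hz hz0 hG hGc⟩
      rw [h0] at this
      exact this rfl
    · rw [← neg_eq_zero, ← contract_boundary, hcω]
      ext G
      by_contra hG
      have h1 := (mem_chains.1 hω.1 _ (contract_apply_ne_zero.1 hG).2).1
      exact hvΓ (Γ.down_closed h1 (by simp))
  -- Contract c at both ends of the edge, in either order. The results are a and b times the same
  -- double contraction of z up to a common sign, and this is nonzero because the edge lies in a
  -- facet.
  have hedge : ∀ u v, u ≠ v → {u, v} ∈ Δ.faces → ∀ a b : k,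
      contract k u c = a • contract k u z → contract k v c = b • contract k v z → a = b := by
    intro u v huv hΔuv a b ha hb
    have e := contract_contract k u v c
    rw [ha, hb, map_smul, map_smul, contract_contract k v u z, smul_neg, neg_neg] at e
    obtain ⟨G, hG, hvG, hGc⟩ := hΔ.exists_facet hΔuv
    have hu : u ∈ G := hvG (by simp)
    have hv : v ∈ G := hvG (by simp)
    have : contract k u (contract k v z) ((G.erase v).erase u) ≠ 0 := by
      rw [contract_apply_ne_zero, Finset.insert_erase (by simp [hu, huv]), contract_apply_ne_zero,
        Finset.insert_erase hv]
      exact ⟨by simp, by simp, hΔ.apply_ne_zero hz hz0 hG hGc⟩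
    have e' := DFunLike.congr_fun e ((G.erase v).erase u)
    rw [Finsupp.smul_apply, Finsupp.smul_apply, smul_eq_mul, smul_eq_mul] at e'
    exact (mul_right_cancel₀ this e').symm
  obtain ⟨u, hu, huΓ⟩ : ∃ u, {u} ∈ Δ.faces ∧ {u} ∉ Γ.faces := by
    obtain ⟨F, hF, hFc⟩ := Δ.exists_card_eq_rank
    obtain ⟨u, hu, huΓ⟩ := hΓΔ.exists_notMem hF (by omega)
    exact ⟨u, Δ.down_closed hF (by simpa using hu), huΓ⟩
  obtain ⟨α, hα⟩ := hex u hu huΓ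
  -- If α worked everywhere, c - α • z would vanish on every face having a vertex outside Γ. All
  -- top-dimensional faces have one, so c = α • z and ω = ∂c = 0.
  obtain ⟨w, hw, hwΓ, hwα⟩ : ∃ w, {w} ∈ Δ.faces ∧ {w} ∉ Γ.faces ∧
      contract k w c ≠ α • contract k w z := by
    by_contra! H
    have hne : c - α • z ≠ 0 := by
      intro h0
      apply hω0
      rw [← hcω, sub_eq_zero.1 h0, map_smul, (mem_cycles.1 hz).2, smul_zero]
    obtain ⟨F, hF : (c - α • z) F ≠ 0⟩ := Finsupp.ne_iff.1 hne
    obtain ⟨hFΔ, hFc⟩ := mem_chains.1 (sub_mem hc (Submodule.smul_mem _ α hz.1)) F hF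
    obtain ⟨w, hwF, hwΓ⟩ := hΓΔ.exists_notMem hFΔ (by unfold dim at hFc; omega)
    have h0 : contract k w (c - α • z) = 0 := by
      rw [map_sub, map_smul, H w (Δ.down_closed hFΔ (by simpa using hwF)) hwΓ, sub_self]
    have : contract k w (c - α • z) (F.erase w) ≠ 0 := by
      rw [contract_apply_ne_zero, Finset.insert_erase hwF]
      exact ⟨by simp, hF⟩
    rw [h0] at this
    exact this rfl
  -- Vertices of Γ go to both sides; the others are sorted by whether their scalar is α. By `hedge`
  -- no face has outside vertices of both kinds, and the intersection is Γ because Γ is induced.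
  refine ⟨{v | {v} ∈ Γ.faces ∨ contract k v c = α • contract k v z},
    {v | {v} ∈ Γ.faces ∨ contract k v c ≠ α • contract k v z}, ?_, ?_, ?_, ?_⟩
  · ext F
    simp only [Finset.mem_union, mem_restrict, ← and_or_left, iff_self_and, Set.mem_ofPred_eq]
    intro hF
    by_contra! H
    obtain ⟨⟨a, haF, haΓ, ha⟩, b, hbF, hbΓ, hb⟩ := H
    have hab : a ≠ b := fun h => ha (h ▸ hb)
    obtain ⟨α', hα'⟩ := hex a (Δ.down_closed hF (by simpa using haF)) haΓ
    rw [hedge a b hab (Δ.down_closed hF (by simp [Finset.insert_subset_iff, haF, hbF])) _ _ hα' hb]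
      at hα'
    exact ha hα'
  · ext F
    simp only [Finset.mem_inter, mem_restrict, Set.mem_ofPred_eq]
    constructor
    · intro hF
      have : ∀ v ∈ F, {v} ∈ Γ.faces := fun v hv => Γ.down_closed hF (by simpa using hv)
      exact ⟨⟨hΓΔ.1 hF, fun v hv => Or.inl (this v hv)⟩, hΓΔ.1 hF, fun v hv => Or.inl (this v hv)⟩
    · rintro ⟨⟨hF, h1⟩, -, h2⟩
      refine hΓΔ.2 F hF fun v hv => ?_
      have := h1 v hv
      have := h2 v hv
      tauto
  · refine ⟨{u}, mem_restrict.2 ⟨hu, by simp [hα]⟩, fun h => ?_⟩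
    have := (mem_restrict.1 h).2 u (by simp)
    simp [hα, huΓ] at this
  · refine ⟨{w}, mem_restrict.2 ⟨hw, by simp [hwα]⟩, fun h => ?_⟩
    have := (mem_restrict.1 h).2 w (by simp)
    simp [hwα, hwΓ] at this

end Separation

end FiniteComplex

namespace FiniteComplex

/-! ### Euler characteristic and the Dehn–Sommerville relations -/

section Euler

variable {V : Type*} {k : Type*} [Field k]

theorem finite_faces_card (Δ : FiniteComplex V) (i : ℤ) :
    {F | F ∈ Δ.faces ∧ (F.card : ℤ) = i + 1}.Finite :=
  Δ.faces.finite_toSet.subset fun _ hF => hF.1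

instance (Δ : FiniteComplex V) (i : ℤ) : Module.Finite k (Δ.chains k i) := by
  have := (Δ.finite_faces_card i).fintype
  exact Module.Finite.equiv
    (Finsupp.supportedEquivFinsupp (M := k) (R := k) {F | F ∈ Δ.faces ∧ (F.card : ℤ) = i + 1}).symm

theorem finrank_chains (Δ : FiniteComplex V) (j : ℕ) :
    Module.finrank k (Δ.chains k ((j : ℤ) - 1)) = Δ.faceCount j := by
  have := (Δ.finite_faces_card (j - 1)).fintype
  rw [chains, LinearEquiv.finrank_eq (Finsupp.supportedEquivFinsupp
    (M := k) (R := k) {F | F ∈ Δ.faces ∧ (F.card : ℤ) = (j - 1 : ℤ) + 1}),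
    Module.finrank_finsupp_self, faceCount, ← Set.toFinset_card]
  congr 1
  ext F
  simp

end Euler

section Euler

variable {V : Type*} [LinearOrder V] {k : Type*} [Field k]

theorem finrank_chains_eq (Δ : FiniteComplex V) (i : ℤ) :
    Module.finrank k (Δ.chains k (i + 1)) =
      Module.finrank k (Δ.cycles k (i + 1)) + Module.finrank k (Δ.boundaries k i) := by
  have h := LinearMap.finrank_range_add_finrank_ker ((boundary k).domRestrict (Δ.chains k (i + 1)))
  have h1 : LinearMap.range ((boundary k).domRestrict (Δ.chains k (i + 1))) = Δ.boundaries k i := by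
    rw [LinearMap.domRestrict, LinearMap.range_comp, Submodule.range_subtype, boundaries]
  have h2 : (LinearMap.ker ((boundary k).domRestrict (Δ.chains k (i + 1)))).map
      (Δ.chains k (i + 1)).subtype = Δ.cycles k (i + 1) := by
    rw [LinearMap.domRestrict, LinearMap.ker_comp, Submodule.map_comap_subtype, cycles]
  rw [h1, ← Submodule.finrank_map_subtype_eq, h2] at h
  omega

theorem IsHomologySphere.finrank_cycles {Δ : FiniteComplex V} (h : Δ.IsHomologySphere k) (i : ℤ) :
    Module.finrank k (Δ.cycles k i) =
      Module.finrank k (Δ.boundaries k i) + if i = Δ.dim then 1 else 0 := by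
  split_ifs with hi
  · subst hi
    have hb : Δ.boundaries k Δ.dim = ⊥ :=
      (Submodule.eq_bot_iff _).2 fun x hx => eq_zero_of_mem_boundaries le_rfl hx
    rw [hb, finrank_bot]
    obtain ⟨z, hz, hz0, h1⟩ := h.exists_fundamental
    refine finrank_eq_one (⟨z, hz⟩ : Δ.cycles k Δ.dim) (fun h => hz0 (congrArg Subtype.val h)) ?_
    rintro ⟨x, hx⟩
    obtain ⟨a, rfl⟩ := h1 x hx
    exact ⟨a, rfl⟩
  · rw [le_antisymm (h.cycles_le_boundaries hi) (Δ.boundaries_le_cycles k i), add_zero]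

/-- The reduced Euler characteristic of a homology sphere. -/
theorem IsHomologySphere.sum_neg_one_pow_faceCount {Δ : FiniteComplex V}
    (h : Δ.IsHomologySphere k) :
    ∑ j ∈ Finset.range (Δ.rank + 1), (-1 : ℤ) ^ j * Δ.faceCount j = (-1) ^ Δ.rank := by
  -- By rank–nullity the partial sums telescope. The last faces counted have m - 1 elements, so the
  -- uncancelled term is the space of boundaries in degree m - 2; the homology line enters once m
  -- exceeds the rank.
  have key : ∀ m : ℕ, ∑ j ∈ Finset.range m, (-1 : ℤ) ^ j * Δ.faceCount j =
      -(-1) ^ m * Module.finrank k (Δ.boundaries k ((m : ℤ) - 2)) +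
        if Δ.rank < m then (-1) ^ Δ.rank else 0 := by
    intro m
    induction m with
    | zero =>
      have hb : Δ.boundaries k (((0 : ℕ) : ℤ) - 2) = ⊥ := by
        refine (Submodule.eq_bot_iff _).2 fun x hx => ?_
        obtain ⟨b, hb, rfl⟩ := mem_boundaries.1 hx
        ext F
        by_contra hF
        have := (mem_chains.1 (boundary_mem_chains rfl hb) F hF).2
        omega
      rw [hb]
      simp
    | succ m ih =>
      rw [Finset.sum_range_succ, ih, ← finrank_chains (k := k)]
      have h1 := Δ.finrank_chains_eq (k := k) ((m : ℤ) - 2)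
      rw [show (m : ℤ) - 2 + 1 = m - 1 by ring, h.finrank_cycles] at h1
      rw [h1, show ((m + 1 : ℕ) : ℤ) - 2 = m - 1 by push_cast; ring]
      have e1 : (m : ℤ) - 1 = Δ.dim ↔ m = Δ.rank := by unfold dim; omega
      simp only [e1]
      rcases lt_trichotomy m Δ.rank with hm | hm | hm
      · rw [if_neg (by omega), if_neg (by omega), if_neg (by omega)]
        push_cast; ring
      · rw [if_neg (by omega), if_pos hm, if_pos (by omega), ← hm]
        push_cast; ring
      · rw [if_pos (by omega), if_neg (by omega), if_pos (by omega)]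
        push_cast; ring
  have hb : Δ.boundaries k (((Δ.rank + 1 : ℕ) : ℤ) - 2) = ⊥ :=
    (Submodule.eq_bot_iff _).2 fun x hx =>
      eq_zero_of_mem_boundaries (by unfold dim; push_cast; omega) hx
  rw [key, hb, if_pos (by omega)]
  simp

end Euler

section Enumeration

variable {V : Type*}

theorem sum_faceCount {M : Type*} [Semiring M] (Δ : FiniteComplex V) (f : ℕ → M) :
    ∑ j ∈ Finset.range (Δ.rank + 1), Δ.faceCount j * f j = ∑ F ∈ Δ.faces, f F.card := by
  rw [← Finset.sum_fiberwise_of_maps_to (t := Finset.range (Δ.rank + 1)) (g := Finset.card)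
    (fun F hF => Finset.mem_range.2 (Nat.lt_succ_of_le (Δ.card_le_rank hF)))]
  refine Finset.sum_congr rfl fun j _ => ?_
  rw [Finset.sum_congr rfl (g := fun _ => f j) (fun F hF => by rw [(Finset.mem_filter.1 hF).2]),
    Finset.sum_const, nsmul_eq_mul, faceCount]

theorem hPoly_eq_sum (Δ : FiniteComplex V) :
    Δ.hPoly = ∑ F ∈ Δ.faces, X ^ F.card * (1 - X) ^ (Δ.rank - F.card) := by
  rw [← Δ.sum_faceCount fun j => X ^ j * (1 - X : ℝ[X]) ^ (Δ.rank - j), hPoly]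
  refine Finset.sum_congr rfl fun j _ => ?_
  rw [mul_assoc]
  simp

end Enumeration

section DehnSommerville

variable {V : Type*} [LinearOrder V] {k : Type*} [Field k]

/-- This is the Euler relation for the link of F, multiplied by (-1)^|F|. -/
theorem IsHomologySphere.sum_superset {Δ : FiniteComplex V} (h : Δ.IsHomologySphere k)
    {F : Finset V} (hF : F ∈ Δ.faces) :
    ∑ G ∈ Δ.faces with F ⊆ G, (-1 : ℤ) ^ G.card = (-1) ^ Δ.rank := by
  have h1 := (h.link hF).sum_neg_one_pow_faceCount
  simp only [mul_comm ((-1 : ℤ) ^ _)] at h1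
  rw [sum_faceCount _ fun j => (-1 : ℤ) ^ j] at h1
  rw [← h.rank_link hF, pow_add, ← h1, Finset.sum_mul]
  refine Finset.sum_nbij' (· \ F) (F ∪ ·) ?_ ?_ ?_ ?_ ?_
  · intro G hG
    obtain ⟨hG, hFG⟩ := Finset.mem_filter.1 hG
    rw [mem_link, Finset.union_sdiff_of_subset hFG]
    exact ⟨Finset.disjoint_sdiff, hG⟩
  · intro G hG
    exact Finset.mem_filter.2 ⟨(mem_link.1 hG).2, Finset.subset_union_left⟩
  · intro G hG
    exact Finset.union_sdiff_of_subset (Finset.mem_filter.1 hG).2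
  · intro G hG
    exact Finset.union_sdiff_cancel_left (mem_link.1 hG).1
  · intro G hG
    rw [← pow_add, Finset.card_sdiff_add_card_eq_card (Finset.mem_filter.1 hG).2]

/-- Weight each F by the alternating count of the faces G containing it, which is a sign by
`sum_superset`. After exchanging the sums, the binomial theorem over the subsets of G produces
x^|G|. The right-hand side is the reversal of `hPoly_eq_sum`, so this is the palindromic symmetry.
-/
theorem IsHomologySphere.hPoly_eq {Δ : FiniteComplex V} (h : Δ.IsHomologySphere k) :
    Δ.hPoly = ∑ F ∈ Δ.faces, (X - 1 : ℝ[X]) ^ (Δ.rank - F.card) := by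
  have h1 : ∀ F ∈ Δ.faces, (X - 1 : ℝ[X]) ^ (Δ.rank - F.card) =
      ∑ G ∈ Δ.faces with F ⊆ G, (-1) ^ (G.card + Δ.rank) * (X - 1 : ℝ[X]) ^ (Δ.rank - F.card) := by
    intro F hF
    have := congrArg (Int.cast : ℤ → ℝ[X]) (h.sum_superset hF)
    push_cast at this
    simp only [pow_add]
    rw [← Finset.sum_mul, ← Finset.sum_mul, this, ← mul_pow, neg_mul_neg, one_mul, one_pow, one_mul]
  rw [Finset.sum_congr rfl h1, hPoly_eq_sum, Finset.sum_comm' (t' := Δ.faces)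
    (s' := Finset.powerset)]
  · refine Finset.sum_congr rfl fun G hG => ?_
    rw [← Finset.mul_sum]
    have hGr := Δ.card_le_rank hG
    have h2 : ∀ F ∈ G.powerset, (X - 1 : ℝ[X]) ^ (Δ.rank - F.card) =
        (X - 1) ^ (Δ.rank - G.card) * (1 ^ F.card * (X - 1) ^ (G.card - F.card)) := by
      intro F hF
      have := Finset.card_le_card (Finset.mem_powerset.1 hF)
      rw [one_pow, one_mul, ← pow_add]
      congr 1
      omega
    rw [Finset.sum_congr rfl h2, ← Finset.mul_sum, Finset.sum_pow_mul_eq_add_pow,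
      add_sub_cancel, ← mul_assoc, mul_comm]
    congr 1
    rw [← neg_sub X 1, neg_pow, show G.card + Δ.rank = Δ.rank - G.card + 2 * G.card by omega,
      pow_add, pow_mul]
    simp
  · intro F G
    rw [Finset.mem_filter, Finset.mem_powerset]
    exact ⟨fun h => ⟨h.2.2, h.2.1⟩, fun h => ⟨Δ.down_closed h.2 h.1, h.2, h.1⟩⟩

end DehnSommerville

end FiniteComplex

/-! ### Palindromic polynomials and γ-polynomials -/

section Gamma

theorem reflect_finset_sum {ι : Type*} (n : ℕ) (s : Finset ι) (f : ι → ℝ[X]) :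
    reflect n (∑ i ∈ s, f i) = ∑ i ∈ s, reflect n (f i) := by
  ext m
  simp [coeff_reflect]

theorem reflect_one_sub_X_pow (n : ℕ) : reflect n ((1 - X : ℝ[X]) ^ n) = (X - 1) ^ n := by
  have hd : (1 - X : ℝ[X]).natDegree ≤ 1 := by compute_degree
  have h1 : reflect 1 (1 - X : ℝ[X]) = X - 1 := by
    rw [reflect_sub, reflect_one, ← pow_one (X : ℝ[X]), reflect_monomial, revAt_le le_rfl]
    simp
  induction n with
  | zero => simp
  | succ n ih =>
    rw [pow_succ, reflect_mul _ _ (by simpa using natDegree_pow_le_of_le n hd) hd, ih, h1, pow_succ]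

theorem reflect_X_pow_mul {n m : ℕ} (h : m ≤ n) :
    reflect n ((X : ℝ[X]) ^ m * (1 - X) ^ (n - m)) = (X - 1) ^ (n - m) := by
  have hd : (1 - X : ℝ[X]).natDegree ≤ 1 := by compute_degree
  obtain ⟨d, rfl⟩ := Nat.exists_eq_add_of_le h
  rw [Nat.add_sub_cancel_left, reflect_mul _ _ (by simp) (by simpa using natDegree_pow_le_of_le d hd),
    reflect_one_sub_X_pow, reflect_monomial, revAt_le le_rfl]
  simp

theorem reflect_one_add_X_pow (n : ℕ) : reflect n ((1 + X : ℝ[X]) ^ n) = (1 + X) ^ n := by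
  have hd : (1 + X : ℝ[X]).natDegree ≤ 1 := by compute_degree
  have h1 : reflect 1 (1 + X : ℝ[X]) = 1 + X := by
    rw [reflect_add, reflect_one, ← pow_one (X : ℝ[X]), reflect_monomial, revAt_le le_rfl]
    simp [add_comm]
  induction n with
  | zero => simp
  | succ n ih =>
    rw [pow_succ, reflect_mul _ _ (by simpa using natDegree_pow_le_of_le n hd) hd, ih, h1]

/-- A palindromic polynomial has a `γ`-polynomial. -/
theorem exists_isGammaPolynomial {n : ℕ} {p : ℝ[X]} (hd : p.natDegree ≤ n)
    (hp : reflect n p = p) : ∃ g, IsGammaPolynomial n p g := by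
  have hone : (1 + X : ℝ[X]).natDegree ≤ 1 := by compute_degree
  induction n using Nat.strong_induction_on generalizing p with
  | _ n ih =>
  have hcoeff : ∀ i ≤ n, p.coeff (n - i) = p.coeff i := by
    intro i hi
    conv_rhs => rw [← hp, coeff_reflect, revAt_le hi]
  rcases Nat.lt_or_ge n 2 with hn | hn
  · refine ⟨C (p.coeff 0), by simp, ?_⟩
    obtain rfl | rfl : n = 0 ∨ n = 1 := by omega
    · simpa using eq_C_of_natDegree_le_zero hd
    · have h1 := hcoeff 1 le_rfl
      conv_lhs => rw [eq_X_add_C_of_natDegree_le_one hd]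
      simp only [Nat.sub_self] at h1
      simp [← h1]
      ring
  -- Subtracting this multiple of (1 + X)^n kills the constant coefficient and, by symmetry, the one
  -- in degree n. Dividing by X leaves a palindromic polynomial for n - 2.
  · set q := p - C (p.coeff 0) * (1 + X) ^ n with hq
    have hqd : q.natDegree ≤ n := by
      refine (natDegree_sub_le_of_le hd (natDegree_C_mul_le _ _ |>.trans
        (by simpa using natDegree_pow_le_of_le n hone))).trans (by simp)
    have hqr : reflect n q = q := by
      rw [hq, reflect_sub, reflect_C_mul, reflect_one_add_X_pow, hp]
    have hq0 : q.coeff 0 = 0 := by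
      rw [hq, coeff_sub, coeff_C_mul, coeff_zero_eq_eval_zero ((1 + X) ^ n)]
      simp
    have hqn : q.coeff n = 0 := by
      rw [← hqr, coeff_reflect, revAt_le le_rfl, Nat.sub_self, hq0]
    obtain ⟨r, hr⟩ := X_dvd_iff.2 hq0
    have hrd : r.natDegree ≤ n - 2 := by
      rw [natDegree_le_iff_coeff_eq_zero]
      intro m hm
      rw [← coeff_X_mul, ← hr]
      rcases Nat.lt_or_ge n (m + 1) with h | h
      · exact coeff_eq_zero_of_natDegree_lt (hqd.trans_lt h)
      · rwa [show m + 1 = n by omega]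
    have hrr : reflect (n - 2) r = r := by
      ext m
      rw [coeff_reflect]
      rcases Nat.lt_or_ge (n - 2) m with h | h
      · rw [revAt_eq_self_of_lt h]
      · rw [revAt_le h, ← coeff_X_mul, ← hr, ← coeff_X_mul r m, ← hr]
        conv_rhs => rw [← hqr, coeff_reflect, revAt_le (by omega)]
        congr 1
        omega
    obtain ⟨g, hg, hrg⟩ := ih (n - 2) (by omega) hrd hrr
    refine ⟨C (p.coeff 0) + X * g, ?_, ?_⟩
    · refine (natDegree_add_le_of_degree_le (n := n / 2) (by simp) ?_)
      refine natDegree_mul_le.trans ?_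
      rw [natDegree_X]
      omega
    · rw [show n / 2 = (n - 2) / 2 + 1 by omega, Finset.sum_range_succ']
      have hpq : p = X * r + C (p.coeff 0) * (1 + X) ^ n := by rw [← hr, hq]; ring
      conv_lhs => rw [hpq, hrg, Finset.mul_sum]
      congr 1
      · refine Finset.sum_congr rfl fun i _ => ?_
        rw [show n - 2 * (i + 1) = n - 2 - 2 * i by omega]
        simp only [coeff_add, coeff_C_succ, coeff_X_mul, zero_add]
        ring
      · simp

end Gamma

namespace FiniteComplex

/-- The Dehn–Sommerville form gives the degree bound, and reflecting the face sum term by term gives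
that same form. -/
theorem IsHomologySphere.exists_isGammaPolynomial {V : Type*} [LinearOrder V] {k : Type*} [Field k]
    {Δ : FiniteComplex V} (h : Δ.IsHomologySphere k) :
    ∃ g, IsGammaPolynomial Δ.rank Δ.hPoly g := by
  refine _root_.exists_isGammaPolynomial ?_ ?_
  · rw [h.hPoly_eq]
    refine natDegree_sum_le_of_forall_le _ _ fun F _ => ?_
    have hd : (X - 1 : ℝ[X]).natDegree ≤ 1 := by compute_degree
    refine (natDegree_pow_le_of_le _ hd).trans ?_
    omega
  · conv_rhs => rw [h.hPoly_eq]
    rw [hPoly_eq_sum, reflect_finset_sum]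
    exact Finset.sum_congr rfl fun F hF => reflect_X_pow_mul (Δ.card_le_rank hF)

end FiniteComplex

namespace FiniteComplex

/-! ### Coning off a subcomplex: faces, flagness and h-polynomial -/

section BaseAndApex

variable {V : Type*}

/-- A finite subset of `V`, as a simplex at the base of a cone with apex `⊥`. -/
def baseSimplex (F : Finset V) : Finset (WithBot V) := F.map ⟨(↑), WithBot.coe_injective⟩

theorem bot_notMem_baseSimplex (F : Finset V) : ⊥ ∉ baseSimplex F := by
  simp [baseSimplex]

theorem baseSimplex_injective : Function.Injective (baseSimplex (V := V)) :=
  Finset.map_injective _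

theorem card_baseSimplex (F : Finset V) : (baseSimplex F).card = F.card := Finset.card_map _

theorem coe_mem_baseSimplex {F : Finset V} {v : V} : (v : WithBot V) ∈ baseSimplex F ↔ v ∈ F := by
  simp [baseSimplex]

theorem exists_of_subset_baseSimplex {H : Finset (WithBot V)} {G : Finset V}
    (h : H ⊆ baseSimplex G) : ∃ F ⊆ G, H = baseSimplex F := Finset.subset_map_iff.1 h

theorem disjoint_baseSimplex {F G : Finset V} :
    Disjoint (baseSimplex F) (baseSimplex G) ↔ Disjoint F G := Finset.disjoint_map _

theorem sum_baseSimplex {A : Type*} [AddCommMonoid A] (F : Finset V) (f : WithBot V → A) :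
    ∑ x ∈ baseSimplex F, f x = ∑ v ∈ F, f v := Finset.sum_map _ _ _

theorem exists_eq_baseSimplex {H : Finset (WithBot V)} (h : ⊥ ∉ H) : ∃ F, H = baseSimplex F := by
  refine ⟨H.preimage (↑) WithBot.coe_injective.injOn, ?_⟩
  ext x
  induction x using WithBot.recBotCoe with
  | bot => exact iff_of_false h (bot_notMem_baseSimplex _)
  | coe v => rw [coe_mem_baseSimplex, Finset.mem_preimage]

variable [DecidableEq V]

/-- The simplex spanned by `⊥` and a simplex at the base of a cone. -/
def apexSimplex (F : Finset V) : Finset (WithBot V) := insert ⊥ (baseSimplex F)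

theorem bot_mem_apexSimplex (F : Finset V) : ⊥ ∈ apexSimplex F := Finset.mem_insert_self _ _

theorem erase_bot_apexSimplex (F : Finset V) : (apexSimplex F).erase ⊥ = baseSimplex F :=
  Finset.erase_insert (bot_notMem_baseSimplex F)

theorem apexSimplex_injective : Function.Injective (apexSimplex (V := V)) := fun F G h =>
  baseSimplex_injective (by rw [← erase_bot_apexSimplex, h, erase_bot_apexSimplex])

theorem baseSimplex_ne_apexSimplex (F G : Finset V) : baseSimplex F ≠ apexSimplex G := fun h =>
  bot_notMem_baseSimplex F (h ▸ bot_mem_apexSimplex G)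

theorem card_apexSimplex (F : Finset V) : (apexSimplex F).card = F.card + 1 := by
  rw [apexSimplex, Finset.card_insert_of_notMem (bot_notMem_baseSimplex F), card_baseSimplex]

theorem baseSimplex_union (F G : Finset V) :
    baseSimplex F ∪ baseSimplex G = baseSimplex (F ∪ G) := (Finset.map_union _ _).symm

theorem baseSimplex_union_apexSimplex (F G : Finset V) :
    baseSimplex F ∪ apexSimplex G = apexSimplex (F ∪ G) := by
  rw [apexSimplex, Finset.union_insert, baseSimplex_union, apexSimplex]

theorem apexSimplex_union_baseSimplex (F G : Finset V) :
    apexSimplex F ∪ baseSimplex G = apexSimplex (F ∪ G) := by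
  rw [apexSimplex, Finset.insert_union, baseSimplex_union, apexSimplex]

theorem disjoint_baseSimplex_apexSimplex {F G : Finset V} :
    Disjoint (baseSimplex F) (apexSimplex G) ↔ Disjoint F G := by
  rw [apexSimplex, Finset.disjoint_insert_right, disjoint_baseSimplex]
  simp [bot_notMem_baseSimplex]

theorem disjoint_apexSimplex_baseSimplex {F G : Finset V} :
    Disjoint (apexSimplex F) (baseSimplex G) ↔ Disjoint F G := by
  rw [disjoint_comm, disjoint_baseSimplex_apexSimplex, disjoint_comm]

theorem eq_baseSimplex_or_apexSimplex (H : Finset (WithBot V)) :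
    (∃ F, H = baseSimplex F) ∨ ∃ F, H = apexSimplex F := by
  by_cases h : ⊥ ∈ H
  · obtain ⟨F, hF⟩ := exists_eq_baseSimplex (H := H.erase ⊥) (by simp)
    exact Or.inr ⟨F, by rw [apexSimplex, ← hF, Finset.insert_erase h]⟩
  · exact Or.inl (exists_eq_baseSimplex h)

theorem baseSimplex_erase (F : Finset V) (v : V) :
    (baseSimplex F).erase v = baseSimplex (F.erase v) := (Finset.map_erase _ _ _).symm

theorem apexSimplex_erase (F : Finset V) (v : V) :
    (apexSimplex F).erase v = apexSimplex (F.erase v) := by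
  rw [apexSimplex, Finset.erase_insert_of_ne (WithBot.bot_ne_coe), baseSimplex_erase, apexSimplex]

end BaseAndApex

section Cone

variable {V : Type*} [DecidableEq V]

/-- The complex `L`, on the ground set enlarged by `⊥`. -/
def base (L : FiniteComplex V) : FiniteComplex (WithBot V) where
  faces := L.faces.image baseSimplex
  empty_mem := Finset.mem_image.2 ⟨∅, L.empty_mem, rfl⟩
  down_closed := by
    intro F G hG hFG
    obtain ⟨G, hG', rfl⟩ := Finset.mem_image.1 hG
    obtain ⟨F, hF, rfl⟩ := exists_of_subset_baseSimplex hFG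
    exact Finset.mem_image_of_mem _ (L.down_closed hG' hF)

/-- The complex `L`, with a cone with apex `⊥` attached along the subcomplex `M`. -/
def coneOff (L M : FiniteComplex V) (h : M.faces ⊆ L.faces) : FiniteComplex (WithBot V) where
  faces := L.faces.image baseSimplex ∪ M.faces.image apexSimplex
  empty_mem := Finset.mem_union_left _ (Finset.mem_image.2 ⟨∅, L.empty_mem, rfl⟩)
  down_closed := by
    intro F G hG hFG
    rw [Finset.mem_union, Finset.mem_image, Finset.mem_image] at hG ⊢
    obtain ⟨G, hG, rfl⟩ | ⟨G, hG, rfl⟩ := hG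
    · obtain ⟨F, hF, rfl⟩ := exists_of_subset_baseSimplex hFG
      exact Or.inl ⟨F, L.down_closed hG hF, rfl⟩
    · rw [apexSimplex, Finset.subset_insert_iff] at hFG
      obtain ⟨E, hE, hEF⟩ := exists_of_subset_baseSimplex hFG
      have hEM := M.down_closed hG hE
      by_cases hF : ⊥ ∈ F
      · exact Or.inr ⟨E, hEM, by rw [apexSimplex, ← hEF, Finset.insert_erase hF]⟩
      · exact Or.inl ⟨E, h hEM, by rw [← hEF, Finset.erase_eq_of_notMem hF]⟩

variable {L M : FiniteComplex V} {h : M.faces ⊆ L.faces} {F : Finset V}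

theorem baseSimplex_mem_base : baseSimplex F ∈ L.base.faces ↔ F ∈ L.faces := by
  simp [base, baseSimplex_injective.eq_iff]

theorem apexSimplex_notMem_base : apexSimplex F ∉ L.base.faces := by
  simp [base, baseSimplex_ne_apexSimplex]

theorem baseSimplex_mem_coneOff : baseSimplex F ∈ (L.coneOff M h).faces ↔ F ∈ L.faces := by
  simp [coneOff, baseSimplex_injective.eq_iff, (baseSimplex_ne_apexSimplex _ _).symm]

theorem apexSimplex_mem_coneOff : apexSimplex F ∈ (L.coneOff M h).faces ↔ F ∈ M.faces := by
  simp [coneOff, apexSimplex_injective.eq_iff, baseSimplex_ne_apexSimplex]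

/-- Faces of complexes on the enlarged ground set can be compared separately on simplices at the
base and on simplices through the apex. -/
theorem ext_base_apex {P Q : FiniteComplex (WithBot V)}
    (hb : ∀ F, baseSimplex F ∈ P.faces ↔ baseSimplex F ∈ Q.faces)
    (ha : ∀ F, apexSimplex F ∈ P.faces ↔ apexSimplex F ∈ Q.faces) : P = Q := by
  ext H
  obtain ⟨F, rfl⟩ | ⟨F, rfl⟩ := eq_baseSimplex_or_apexSimplex H
  · exact hb F
  · exact ha F

theorem link_mono (h : M.faces ⊆ L.faces) (hF : F ∈ M.faces) :
    (M.link F hF).faces ⊆ (L.link F (h hF)).faces := by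
  intro G hG
  rw [mem_link] at hG ⊢
  exact ⟨hG.1, h hG.2⟩

/-- With the next two lemmas this lists the links in a coned complex: coned off again at a base face
in M, unchanged at other base faces, and links in M at faces through the apex. -/
theorem link_coneOff_of_mem (hF : F ∈ M.faces) :
    (L.coneOff M h).link (baseSimplex F) (baseSimplex_mem_coneOff.2 (h hF)) =
      (L.link F (h hF)).coneOff (M.link F hF) (link_mono h hF) := by
  refine ext_base_apex (fun G => ?_) fun G => ?_
  · rw [mem_link, baseSimplex_union, disjoint_baseSimplex, baseSimplex_mem_coneOff,
      baseSimplex_mem_coneOff, mem_link]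
  · rw [mem_link, baseSimplex_union_apexSimplex, disjoint_baseSimplex_apexSimplex,
      apexSimplex_mem_coneOff, apexSimplex_mem_coneOff, mem_link]

theorem link_coneOff_of_notMem (hF : F ∈ L.faces) (hFM : F ∉ M.faces) :
    (L.coneOff M h).link (baseSimplex F) (baseSimplex_mem_coneOff.2 hF) = (L.link F hF).base := by
  refine ext_base_apex (fun G => ?_) fun G => ?_
  · rw [mem_link, baseSimplex_union, disjoint_baseSimplex, baseSimplex_mem_coneOff,
      baseSimplex_mem_base, mem_link]
  · rw [mem_link, baseSimplex_union_apexSimplex, disjoint_baseSimplex_apexSimplex,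
      apexSimplex_mem_coneOff]
    exact iff_of_false (fun H => hFM (M.down_closed H.2 Finset.subset_union_left))
      apexSimplex_notMem_base

theorem link_coneOff_apexSimplex (hF : F ∈ M.faces) :
    (L.coneOff M h).link (apexSimplex F) (apexSimplex_mem_coneOff.2 hF) = (M.link F hF).base := by
  refine ext_base_apex (fun G => ?_) fun G => ?_
  · rw [mem_link, apexSimplex_union_baseSimplex, disjoint_apexSimplex_baseSimplex,
      apexSimplex_mem_coneOff, baseSimplex_mem_base, mem_link]
  · rw [mem_link]
    refine iff_of_false (fun H => ?_) apexSimplex_notMem_base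
    exact Finset.disjoint_left.1 H.1 (bot_mem_apexSimplex F) (bot_mem_apexSimplex G)

theorem rank_base : L.base.rank = L.rank := by
  obtain ⟨F, hF, hFc⟩ := L.exists_card_eq_rank
  refine rank_eq_of_forall ?_ (baseSimplex_mem_base.2 hF) (by rw [card_baseSimplex, hFc])
  intro H hH
  obtain ⟨G, rfl⟩ | ⟨G, rfl⟩ := eq_baseSimplex_or_apexSimplex H
  · rw [card_baseSimplex]
    exact L.card_le_rank (baseSimplex_mem_base.1 hH)
  · exact absurd hH apexSimplex_notMem_base

theorem dim_base : L.base.dim = L.dim := by rw [dim, rank_base, dim]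

theorem rank_coneOff (hr : L.rank ≤ M.rank + 1) : (L.coneOff M h).rank = M.rank + 1 := by
  obtain ⟨F, hF, hFc⟩ := M.exists_card_eq_rank
  refine rank_eq_of_forall ?_ (apexSimplex_mem_coneOff.2 hF) (by rw [card_apexSimplex, hFc])
  intro H hH
  obtain ⟨G, rfl⟩ | ⟨G, rfl⟩ := eq_baseSimplex_or_apexSimplex H
  · rw [card_baseSimplex]
    exact (L.card_le_rank (baseSimplex_mem_coneOff.1 hH)).trans hr
  · rw [card_apexSimplex]
    exact Nat.succ_le_succ (M.card_le_rank (apexSimplex_mem_coneOff.1 hH))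

theorem hPoly_base : L.base.hPoly = L.hPoly := by
  rw [hPoly_eq_sum, hPoly_eq_sum, base, Finset.sum_image baseSimplex_injective.injOn]
  refine Finset.sum_congr rfl fun F _ => ?_
  rw [card_baseSimplex, ← L.rank_base]
  rfl

/-- A face of M reappears through the apex with one more vertex, in a complex of rank one more than
M, so its power of 1 - X is the same and it gains a factor X. -/
theorem hPoly_coneOff (hr : L.rank = M.rank + 1) :
    (L.coneOff M h).hPoly = L.hPoly + X * M.hPoly := by
  rw [hPoly_eq_sum, hPoly_eq_sum, hPoly_eq_sum, rank_coneOff hr.le, coneOff, Finset.sum_union,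
    Finset.sum_image baseSimplex_injective.injOn, Finset.sum_image apexSimplex_injective.injOn,
    Finset.mul_sum, hr]
  · congr 1
    · exact Finset.sum_congr rfl fun F _ => by rw [card_baseSimplex]
    · refine Finset.sum_congr rfl fun F _ => ?_
      rw [card_apexSimplex, Nat.add_sub_add_right, pow_succ']
      ring
  · rw [Finset.disjoint_left]
    intro H h1 h2
    obtain ⟨F, -, rfl⟩ := Finset.mem_image.1 h1
    obtain ⟨G, -, hG⟩ := Finset.mem_image.1 h2
    exact baseSimplex_ne_apexSimplex F G hG.symm

theorem baseSimplex_pair (u v : V) : ({(u : WithBot V), (v : WithBot V)} : Finset (WithBot V)) =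
    baseSimplex {u, v} := by
  simp [baseSimplex]

/-- The base of a clique through the apex is a face of L by flagness, with all its vertices in M;
inducedness puts it in M. -/
theorem IsFlag.coneOff (hL : L.IsFlag) (hM : M.IsInducedSubcomplex L) :
    (L.coneOff M hM.1).IsFlag := by
  intro H hH
  have hLF : ∀ F : Finset V, (∀ v ∈ F, (v : WithBot V) ∈ H) → F ∈ L.faces := by
    intro F hF
    refine hL F fun u hu v hv => ?_
    have := hH u (hF u hu) v (hF v hv)
    rwa [baseSimplex_pair, baseSimplex_mem_coneOff] at this
  obtain ⟨F, rfl⟩ | ⟨F, rfl⟩ := eq_baseSimplex_or_apexSimplex H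
  · exact baseSimplex_mem_coneOff.2 (hLF F fun v hv => coe_mem_baseSimplex.2 hv)
  · have hmem : ∀ v ∈ F, (v : WithBot V) ∈ apexSimplex F := fun v hv =>
      Finset.mem_insert_of_mem (coe_mem_baseSimplex.2 hv)
    refine apexSimplex_mem_coneOff.2 (hM.2 F (hLF F hmem) fun v hv => ?_)
    have := hH ⊥ (bot_mem_apexSimplex F) v (hmem v hv)
    have e : ({⊥, (v : WithBot V)} : Finset (WithBot V)) = apexSimplex {v} := by
      simp [apexSimplex, baseSimplex]
    rwa [e, apexSimplex_mem_coneOff] at this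

end Cone

/-! ### Homology of a coned-off complex -/

section BaseChains

variable {V : Type*} (k : Type*) [Field k]

/-- Chains at the base of a cone. -/
noncomputable def baseMap : (Finset V →₀ k) →ₗ[k] (Finset (WithBot V) →₀ k) :=
  Finsupp.lmapDomain k k baseSimplex

theorem baseMap_single (F : Finset V) (a : k) :
    baseMap k (Finsupp.single F a) = Finsupp.single (baseSimplex F) a := Finsupp.mapDomain_single

variable {k}

theorem baseMap_apply_baseSimplex (c : Finset V →₀ k) (F : Finset V) :
    baseMap k c (baseSimplex F) = c F := Finsupp.mapDomain_apply baseSimplex_injective _ _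

theorem baseMap_injective : Function.Injective (baseMap (V := V) k) :=
  Finsupp.mapDomain_injective baseSimplex_injective

end BaseChains

section ConeChains

variable {V : Type*} [LinearOrder V] (k : Type*) [Field k]

/-- The cone on a chain. -/
noncomputable def apexMap : (Finset V →₀ k) →ₗ[k] (Finset (WithBot V) →₀ k) :=
  Finsupp.lmapDomain k k apexSimplex

theorem incidence_baseSimplex (v : V) (F : Finset V) :
    incidence k (v : WithBot V) (baseSimplex F) = incidence k v F := by
  unfold incidence baseSimplex
  rw [Finset.filter_map, Finset.card_map]
  congr 3
  ext w
  simp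

theorem incidence_apexSimplex (v : V) (F : Finset V) :
    incidence k (v : WithBot V) (apexSimplex F) = - incidence k v F := by
  rw [← incidence_baseSimplex k v F, incidence, incidence, apexSimplex]
  rw [Finset.filter_insert, if_pos (WithBot.bot_lt_coe v), Finset.card_insert_of_notMem, pow_succ]
  · ring
  · simp [bot_notMem_baseSimplex]

theorem incidence_bot (H : Finset (WithBot V)) : incidence k ⊥ H = 1 := by
  simp [incidence]

theorem apexMap_single (F : Finset V) (a : k) :
    apexMap k (Finsupp.single F a) = Finsupp.single (apexSimplex F) a := Finsupp.mapDomain_single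

theorem boundary_baseMap (c : Finset V →₀ k) :
    boundary k (baseMap k c) = baseMap k (boundary k c) := by
  induction c using Finsupp.induction_linear with
  | zero => simp
  | add f g hf hg => simp only [map_add, hf, hg]
  | single F a =>
    simp only [baseMap_single, boundary_single, map_smul, map_sum, sum_baseSimplex,
      incidence_baseSimplex, baseSimplex_erase]

/-- As ⊥ precedes all other vertices, it is deleted with sign 1 and shifts every other position by
one, which gives the minus sign. -/
theorem boundary_apexMap (c : Finset V →₀ k) :
    boundary k (apexMap k c) = baseMap k c - apexMap k (boundary k c) := by
  induction c using Finsupp.induction_linear with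
  | zero => simp
  | add f g hf hg => simp only [map_add, hf, hg]; abel
  | single F a =>
    rw [apexMap_single, boundary_single, apexSimplex,
      Finset.sum_insert (bot_notMem_baseSimplex F), ← apexSimplex, sum_baseSimplex,
      erase_bot_apexSimplex, incidence_bot]
    simp only [incidence_apexSimplex, apexSimplex_erase, boundary_single, map_smul, map_sum,
      baseMap_single, apexMap_single, neg_smul, Finset.sum_neg_distrib, smul_add, one_smul, smul_neg]
    simp [sub_eq_add_neg]

variable {k}

theorem baseMap_apply_apexSimplex (c : Finset V →₀ k) (F : Finset V) :
    baseMap k c (apexSimplex F) = 0 :=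
  Finsupp.mapDomain_of_notMem_range _ _ (by rintro ⟨G, hG⟩; exact baseSimplex_ne_apexSimplex _ _ hG)

theorem apexMap_apply_apexSimplex (c : Finset V →₀ k) (F : Finset V) :
    apexMap k c (apexSimplex F) = c F := Finsupp.mapDomain_apply apexSimplex_injective _ _

theorem apexMap_apply_baseSimplex (c : Finset V →₀ k) (F : Finset V) :
    apexMap k c (baseSimplex F) = 0 :=
  Finsupp.mapDomain_of_notMem_range _ _ (by
    rintro ⟨G, hG⟩; exact baseSimplex_ne_apexSimplex _ _ hG.symm)

theorem exists_eq_baseMap_add_apexMap (x : Finset (WithBot V) →₀ k) :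
    ∃ y m : Finset V →₀ k, x = baseMap k y + apexMap k m := by
  refine ⟨x.comapDomain baseSimplex baseSimplex_injective.injOn,
    x.comapDomain apexSimplex apexSimplex_injective.injOn, ?_⟩
  ext H
  obtain ⟨F, rfl⟩ | ⟨F, rfl⟩ := eq_baseSimplex_or_apexSimplex H
  · rw [Finsupp.add_apply, baseMap_apply_baseSimplex, apexMap_apply_baseSimplex, add_zero,
      Finsupp.comapDomain_apply]
  · rw [Finsupp.add_apply, baseMap_apply_apexSimplex, apexMap_apply_apexSimplex, zero_add,
      Finsupp.comapDomain_apply]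

theorem baseMap_add_apexMap_inj {y y' m m' : Finset V →₀ k} :
    baseMap k y + apexMap k m = baseMap k y' + apexMap k m' ↔ y = y' ∧ m = m' := by
  refine ⟨fun h => ⟨?_, ?_⟩, by rintro ⟨rfl, rfl⟩; rfl⟩
  · ext F
    simpa only [Finsupp.add_apply, baseMap_apply_baseSimplex, apexMap_apply_baseSimplex, add_zero]
      using DFunLike.congr_fun h (baseSimplex F)
  · ext F
    simpa only [Finsupp.add_apply, baseMap_apply_apexSimplex, apexMap_apply_apexSimplex, zero_add]
      using DFunLike.congr_fun h (apexSimplex F)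

theorem baseMap_add_apexMap_eq_zero {y m : Finset V →₀ k} :
    baseMap k y + apexMap k m = 0 ↔ y = 0 ∧ m = 0 := by
  rw [← baseMap_add_apexMap_inj, map_zero, map_zero, add_zero]

theorem boundary_baseMap_add_apexMap (y m : Finset V →₀ k) :
    boundary k (baseMap k y + apexMap k m) =
      baseMap k (boundary k y + m) + apexMap k (-boundary k m) := by
  rw [map_add, boundary_baseMap, boundary_apexMap, map_add, map_neg]
  abel

variable {L M : FiniteComplex V} {h : M.faces ⊆ L.faces}

theorem mem_chains_coneOff {i : ℤ} {y m : Finset V →₀ k} :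
    baseMap k y + apexMap k m ∈ (L.coneOff M h).chains k (i + 1) ↔
      y ∈ L.chains k (i + 1) ∧ m ∈ M.chains k i := by
  simp only [mem_chains]
  constructor
  · refine fun H => ⟨fun F hF => ?_, fun F hF => ?_⟩
    · have := H (baseSimplex F) (by
        rwa [Finsupp.add_apply, baseMap_apply_baseSimplex, apexMap_apply_baseSimplex, add_zero])
      rwa [baseSimplex_mem_coneOff, card_baseSimplex] at this
    · have := H (apexSimplex F) (by
        rwa [Finsupp.add_apply, baseMap_apply_apexSimplex, apexMap_apply_apexSimplex, zero_add])
      rw [apexSimplex_mem_coneOff, card_apexSimplex] at this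
      exact ⟨this.1, by have := this.2; push_cast at this; omega⟩
  · rintro ⟨hy, hm⟩ H hH
    obtain ⟨F, rfl⟩ | ⟨F, rfl⟩ := eq_baseSimplex_or_apexSimplex H
    · rw [Finsupp.add_apply, baseMap_apply_baseSimplex, apexMap_apply_baseSimplex, add_zero] at hH
      rw [baseSimplex_mem_coneOff, card_baseSimplex]
      exact hy F hH
    · rw [Finsupp.add_apply, baseMap_apply_apexSimplex, apexMap_apply_apexSimplex, zero_add] at hH
      rw [apexSimplex_mem_coneOff, card_apexSimplex]
      exact ⟨(hm F hH).1, by have := (hm F hH).2; push_cast; omega⟩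

theorem mem_cycles_coneOff {i : ℤ} {y m : Finset V →₀ k} :
    baseMap k y + apexMap k m ∈ (L.coneOff M h).cycles k (i + 1) ↔
      y ∈ L.chains k (i + 1) ∧ m ∈ M.cycles k i ∧ boundary k y + m = 0 := by
  rw [mem_cycles, mem_chains_coneOff, boundary_baseMap_add_apexMap, baseMap_add_apexMap_eq_zero,
    neg_eq_zero, mem_cycles]
  tauto

/-- When L is acyclic in this degree, the class of a cycle is read off its cone part, one degree
lower in M. If m = ∂m', then y + m' is a cycle of L, and a chain filling it completes the filling.
-/
theorem mem_boundaries_coneOff {i : ℤ} (hL : L.cycles k (i + 1) ≤ L.boundaries k (i + 1))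
    {y m : Finset V →₀ k} (hx : baseMap k y + apexMap k m ∈ (L.coneOff M h).cycles k (i + 1)) :
    baseMap k y + apexMap k m ∈ (L.coneOff M h).boundaries k (i + 1) ↔ m ∈ M.boundaries k i := by
  rw [mem_cycles_coneOff] at hx
  obtain ⟨hy, hm, hym⟩ := hx
  constructor
  · rintro ⟨b, hb, hbx⟩
    obtain ⟨y', m', rfl⟩ := exists_eq_baseMap_add_apexMap b
    rw [boundary_baseMap_add_apexMap, baseMap_add_apexMap_inj] at hbx
    rw [← hbx.2]
    exact neg_mem ⟨m', (mem_chains_coneOff.1 hb).2, rfl⟩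
  · rintro ⟨m', hm', rfl⟩
    obtain ⟨y', hy', hyy⟩ := hL (x := y + m')
      (mem_cycles.2 ⟨add_mem hy (chains_mono h _ hm'), by rw [map_add, hym]⟩)
    refine ⟨baseMap k y' + apexMap k (-m'), mem_chains_coneOff.2 ⟨hy', neg_mem hm'⟩, ?_⟩
    rw [boundary_baseMap_add_apexMap, hyy, map_neg (boundary k), neg_neg, add_neg_cancel_right]

theorem cycles_coneOff_le_boundaries {i : ℤ}
    (hL : L.cycles k (i + 1) ≤ L.boundaries k (i + 1)) (hM : M.cycles k i ≤ M.boundaries k i) :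
    (L.coneOff M h).cycles k (i + 1) ≤ (L.coneOff M h).boundaries k (i + 1) := by
  intro x hx
  obtain ⟨y, m, rfl⟩ := exists_eq_baseMap_add_apexMap x
  exact (mem_boundaries_coneOff hL hx).2 (hM (mem_cycles_coneOff.1 hx).2.1)

/-- The generator caps the cone over w with a chain of L whose boundary is -w. -/
theorem HasLine.coneOff {i : ℤ} (hL : ∀ j, L.cycles k j ≤ L.boundaries k j) (hM : M.HasLine k i) :
    (L.coneOff M h).HasLine k (i + 1) := by
  obtain ⟨w, hw, hw1, hw2⟩ := hM
  obtain ⟨y₀, hy₀, hyw⟩ := hL i (neg_mem (cycles_mono h i hw))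
  have hz : baseMap k y₀ + apexMap k w ∈ (L.coneOff M h).cycles k (i + 1) :=
    mem_cycles_coneOff.2 ⟨hy₀, hw, by rw [hyw, neg_add_cancel]⟩
  refine ⟨_, hz, fun hb => hw1 ((mem_boundaries_coneOff (hL _) hz).1 hb), fun x hx => ?_⟩
  obtain ⟨y, m, rfl⟩ := exists_eq_baseMap_add_apexMap x
  obtain ⟨a, ha⟩ := hw2 m (mem_cycles_coneOff.1 hx).2.1
  refine ⟨a, ?_⟩
  have e : baseMap k y + apexMap k m - a • (baseMap k y₀ + apexMap k w) =
      baseMap k (y - a • y₀) + apexMap k (m - a • w) := by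
    simp only [map_sub, map_smul, smul_add]
    abel
  have hc := sub_mem hx (Submodule.smul_mem _ a hz)
  rw [e] at hc ⊢
  exact (mem_boundaries_coneOff (hL _) hc).2 ha

theorem mem_chains_base {i : ℤ} {x : Finset (WithBot V) →₀ k} :
    x ∈ L.base.chains k i ↔ ∃ y ∈ L.chains k i, baseMap k y = x := by
  constructor
  · intro hx
    obtain ⟨y, m, rfl⟩ := exists_eq_baseMap_add_apexMap x
    rw [mem_chains] at hx
    have hm : m = 0 := by
      ext F
      by_contra hF
      refine apexSimplex_notMem_base (hx (apexSimplex F) ?_).1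
      rwa [Finsupp.add_apply, baseMap_apply_apexSimplex, apexMap_apply_apexSimplex, zero_add]
    subst hm
    rw [map_zero, add_zero] at hx ⊢
    refine ⟨y, mem_chains.2 fun F hF => ?_, rfl⟩
    have := hx (baseSimplex F) (by rwa [baseMap_apply_baseSimplex])
    rwa [baseSimplex_mem_base, card_baseSimplex] at this
  · rintro ⟨y, hy, rfl⟩
    rw [mem_chains] at hy ⊢
    intro H hH
    obtain ⟨F, rfl⟩ | ⟨F, rfl⟩ := eq_baseSimplex_or_apexSimplex H
    · rw [baseMap_apply_baseSimplex] at hH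
      rw [baseSimplex_mem_base, card_baseSimplex]
      exact hy F hH
    · exact absurd (baseMap_apply_apexSimplex y F) hH

theorem mem_cycles_base {i : ℤ} {x : Finset (WithBot V) →₀ k} :
    x ∈ L.base.cycles k i ↔ ∃ y ∈ L.cycles k i, baseMap k y = x := by
  rw [mem_cycles, mem_chains_base]
  constructor
  · rintro ⟨⟨y, hy, rfl⟩, hx⟩
    rw [boundary_baseMap] at hx
    exact ⟨y, mem_cycles.2 ⟨hy, baseMap_injective (by rw [hx, map_zero])⟩, rfl⟩
  · rintro ⟨y, hy, rfl⟩
    rw [mem_cycles] at hy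
    exact ⟨⟨y, hy.1, rfl⟩, by rw [boundary_baseMap, hy.2, map_zero]⟩

theorem baseMap_mem_boundaries {i : ℤ} {y : Finset V →₀ k} :
    baseMap k y ∈ L.base.boundaries k i ↔ y ∈ L.boundaries k i := by
  rw [mem_boundaries, mem_boundaries]
  constructor
  · rintro ⟨b, hb, hby⟩
    obtain ⟨b, hb', rfl⟩ := mem_chains_base.1 hb
    rw [boundary_baseMap] at hby
    exact ⟨b, hb', baseMap_injective hby⟩
  · rintro ⟨b, hb, rfl⟩
    exact ⟨_, mem_chains_base.2 ⟨b, hb, rfl⟩, boundary_baseMap k b⟩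

theorem cycles_base_le_boundaries {i : ℤ} (hL : L.cycles k i ≤ L.boundaries k i) :
    L.base.cycles k i ≤ L.base.boundaries k i := by
  intro x hx
  obtain ⟨y, hy, rfl⟩ := mem_cycles_base.1 hx
  exact baseMap_mem_boundaries.2 (hL hy)

theorem HasLine.base {i : ℤ} (hL : L.HasLine k i) : L.base.HasLine k i := by
  obtain ⟨w, hw, hw1, hw2⟩ := hL
  refine ⟨_, mem_cycles_base.2 ⟨w, hw, rfl⟩, fun hb => hw1 (baseMap_mem_boundaries.1 hb),
    fun x hx => ?_⟩
  obtain ⟨y, hy, rfl⟩ := mem_cycles_base.1 hx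
  obtain ⟨a, ha⟩ := hw2 y hy
  exact ⟨a, by rwa [← map_smul, ← map_sub, baseMap_mem_boundaries]⟩

end ConeChains

section ConeSphere

variable {V : Type*} [LinearOrder V] {k : Type*} [Field k] {Δ B : FiniteComplex V}

theorem IsHomologyBall.rank_boundary (h : Δ.IsHomologyBall k B) : Δ.rank = B.rank + 1 := by
  have := h.2.2.1
  unfold dim at this
  omega

/-- Attaching a cone along the boundary turns a homology ball into a homology sphere. -/
theorem IsHomologyBall.coneOff (h : Δ.IsHomologyBall k B) :
    (Δ.coneOff B h.1).IsHomologySphere k := by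
  have hr := h.rank_boundary
  have hB := isHomologySphere_iff.1 h.2.1
  have hΔ := h.2.2.2
  simp only [nonempty_reducedHomology, subsingleton_reducedHomology] at hΔ
  rw [isHomologySphere_iff]
  intro H hH
  obtain ⟨F, rfl⟩ | ⟨F, rfl⟩ := eq_baseSimplex_or_apexSimplex H
  · rw [baseSimplex_mem_coneOff] at hH
    by_cases hFB : F ∈ B.faces
    · rw [link_coneOff_of_mem hFB]
      have hac : ∀ j, (Δ.link F hH).cycles k j ≤ (Δ.link F hH).boundaries k j := fun j =>
        (hΔ F hH j).2 fun hc => hc.1 hFB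
      have hd : ((Δ.link F hH).coneOff (B.link F hFB) (link_mono h.1 hFB)).dim =
          (B.link F hFB).dim + 1 := by
        -- An upper bound for the rank of the link in the ball suffices: the cone over the link in B
        -- already attains the dimension.
        have h1 := h.2.1.rank_link hFB
        have h2 := Δ.rank_link_add_card_le hH
        unfold dim
        rw [rank_coneOff (by omega)]
        push_cast
        ring
      rw [hd]
      refine ⟨(hB F hFB).1.coneOff hac, fun i hi => ?_⟩
      obtain ⟨j, rfl⟩ : ∃ j, i = j + 1 := ⟨i - 1, by ring⟩
      exact cycles_coneOff_le_boundaries (hac _) ((hB F hFB).2 j fun hj => hi (by rw [hj]))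
    · rw [link_coneOff_of_notMem hH hFB, dim_base]
      exact ⟨((hΔ F hH _).1 ⟨hFB, rfl⟩).base, fun i hi =>
        cycles_base_le_boundaries ((hΔ F hH i).2 fun hc => hi hc.2)⟩
  · rw [apexSimplex_mem_coneOff] at hH
    rw [link_coneOff_apexSimplex hH, dim_base]
    exact ⟨(hB F hH).1.base, fun i hi => cycles_base_le_boundaries ((hB F hH).2 i hi)⟩

end ConeSphere

end FiniteComplex

/-- Each exponent m - 2i grows by one, so the same γ-coefficients serve for m + 1. For odd m the sum
gains an index, where the coefficient of g is zero by the degree bound. This makes γ-polynomials in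
consecutive dimensions comparable. -/
theorem IsGammaPolynomial.one_add_X_mul {m : ℕ} {p g : ℝ[X]} (h : IsGammaPolynomial m p g) :
    (1 + X) * p = ∑ i ∈ Finset.range ((m + 1) / 2 + 1),
      C (g.coeff i) * X ^ i * (1 + X) ^ (m + 1 - 2 * i) := by
  obtain ⟨hd, hp⟩ := h
  conv_lhs => rw [hp, Finset.mul_sum]
  rw [← Finset.sum_subset (Finset.range_mono (show m / 2 + 1 ≤ (m + 1) / 2 + 1 by omega))]
  · refine Finset.sum_congr rfl fun i hi => ?_
    rw [Finset.mem_range] at hi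
    rw [show m + 1 - 2 * i = m - 2 * i + 1 by omega, pow_succ]
    ring
  · intro i _ hi
    rw [Finset.mem_range] at hi
    rw [coeff_eq_zero_of_natDegree_lt (by omega)]
    simp

namespace FiniteComplex

/-! ### Flag links and comparison of γ-polynomials -/

section Links

variable {V : Type*} [DecidableEq V] {Δ : FiniteComplex V} {v : V}

theorem IsFlag.insert_mem (h : Δ.IsFlag) (hv : {v} ∈ Δ.faces) {F : Finset V}
    (hF : ∀ u ∈ F, {v, u} ∈ Δ.faces) (hFΔ : ∀ u ∈ F, ∀ w ∈ F, {u, w} ∈ Δ.faces) :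
    insert v F ∈ Δ.faces := by
  refine h _ fun u hu w hw => ?_
  rw [Finset.mem_insert] at hu hw
  obtain rfl | hu := hu <;> obtain rfl | hw := hw
  · simpa using hv
  · exact hF w hw
  · rw [Finset.pair_comm]; exact hF u hu
  · exact hFΔ u hu w hw

theorem IsFlag.link_singleton (h : Δ.IsFlag) (hv : {v} ∈ Δ.faces) : (Δ.link {v} hv).IsFlag := by
  intro F hF
  have hF' : ∀ u ∈ F, ∀ w ∈ F, v ∉ ({u, w} : Finset V) ∧ insert v {u, w} ∈ Δ.faces :=
    fun u hu w hw => mem_link_singleton.1 (hF u hu w hw)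
  rw [mem_link_singleton]
  refine ⟨fun hvF => (hF' v hvF v hvF).1 (by simp), h.insert_mem hv (fun u hu => ?_) ?_⟩
  · exact Δ.down_closed (hF' u hu u hu).2 (by simp)
  · exact fun u hu w hw => Δ.down_closed (hF' u hu w hw).2 (Finset.subset_insert _ _)

/-- A face whose vertices are all adjacent to v forms a clique together with v. -/
theorem IsFlag.isInducedSubcomplex_link_singleton (h : Δ.IsFlag) (hv : {v} ∈ Δ.faces) :
    (Δ.link {v} hv).IsInducedSubcomplex Δ := by
  refine ⟨Finset.filter_subset _ _, fun F hF hFv => ?_⟩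
  have hFv' : ∀ u ∈ F, v ∉ ({u} : Finset V) ∧ insert v {u} ∈ Δ.faces :=
    fun u hu => mem_link_singleton.1 (hFv u hu)
  rw [mem_link_singleton]
  refine ⟨fun hvF => (hFv' v hvF).1 (by simp), h.insert_mem hv (fun u hu => (hFv' u hu).2) ?_⟩
  exact fun u hu w hw => Δ.down_closed hF (by simp [Finset.insert_subset_iff, hu, hw])

end Links

/-- Inclusion–exclusion over faces. Those of M, weighted by the rank of L, sum to (1 - X) h(M),
since the rank of M is one less; the two thetas subtract h(M) twice, which leaves 1 + X. -/
theorem IsDecomposition.hPoly_eq {V : Type*} [DecidableEq V] {L L₁ L₂ M : FiniteComplex V}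
    (h : IsDecomposition L L₁ L₂ M) (h1 : L₁.rank = L.rank) (h2 : L₂.rank = L.rank)
    (hr : M.rank + 1 = L.rank) :
    L.hPoly = L₁.thetaPoly M + L₂.thetaPoly M + (1 + X) * M.hPoly := by
  have hM : ∑ F ∈ M.faces, X ^ F.card * (1 - X : ℝ[X]) ^ (L.rank - F.card) =
      (1 - X) * M.hPoly := by
    rw [hPoly_eq_sum, Finset.mul_sum]
    refine Finset.sum_congr rfl fun F hF => ?_
    have := M.card_le_rank hF
    rw [show L.rank - F.card = M.rank - F.card + 1 by omega, pow_succ]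
    ring
  have hu := Finset.sum_union_inter (s₁ := L₁.faces) (s₂ := L₂.faces)
    (f := fun F => X ^ F.card * (1 - X : ℝ[X]) ^ (L.rank - F.card))
  rw [← h.union, ← h.inter, ← hPoly_eq_sum, hM] at hu
  rw [thetaPoly, thetaPoly, L₁.hPoly_eq_sum, L₂.hPoly_eq_sum, h1, h2]
  linear_combination hu

theorem IsGammaPositive.gammaLE {V : Type*} [LinearOrder V] {k : Type*} [Field k]
    {Δ D₁ D₂ Γ : FiniteComplex V} (h : IsDecomposition Δ D₁ D₂ Γ) (h1 : D₁.rank = Δ.rank)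
    (h2 : D₂.rank = Δ.rank) (hr : Γ.rank + 1 = Δ.rank) (hΓ : Γ.IsHomologySphere k)
    (hp1 : IsGammaPositive Δ.rank (D₁.thetaPoly Γ))
    (hp2 : IsGammaPositive Δ.rank (D₂.thetaPoly Γ)) : GammaLE Γ Δ := by
  obtain ⟨g, hg⟩ := hΓ.exists_isGammaPolynomial
  obtain ⟨a, ha, ha'⟩ := hp1
  obtain ⟨b, hb, hb'⟩ := hp2
  -- The γ-polynomial of Δ is that of Γ plus the γ-coefficients a and b of the two thetas. Beyond
  -- the range a and b are arbitrary nonnegative numbers, so the sum is truncated.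
  have hcoeff : ∀ i, (∑ j ∈ Finset.range (Δ.rank / 2 + 1),
      monomial j (a j + b j + g.coeff j)).coeff i =
        if i ∈ Finset.range (Δ.rank / 2 + 1) then a i + b i + g.coeff i else 0 := by
    intro i
    simp only [finsetSum_coeff, coeff_monomial, Finset.sum_ite_eq']
  refine ⟨g, ∑ j ∈ Finset.range (Δ.rank / 2 + 1), monomial j (a j + b j + g.coeff j), hg, ⟨?_, ?_⟩,
    fun i => ?_⟩
  · rw [natDegree_le_iff_coeff_eq_zero]
    intro i hi
    rw [hcoeff, if_neg (by rw [Finset.mem_range]; omega)]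
  · rw [h.hPoly_eq h1 h2 hr, hg.one_add_X_mul, hr, ha', hb', ← Finset.sum_add_distrib,
      ← Finset.sum_add_distrib]
    refine Finset.sum_congr rfl fun i hi => ?_
    rw [hcoeff, if_pos hi]
    simp only [C_add]
    ring
  · rw [hcoeff]
    split_ifs with hi
    · linarith [ha i, hb i]
    · rw [Finset.mem_range] at hi
      rw [coeff_eq_zero_of_natDegree_lt]
      have := hg.1
      omega

/-- θ is the h-polynomial of the coned complex minus (1 + X) h(B), so its γ-coefficients are the
differences in the hypothesis. The boundary appears as `B.base` because that is the link of the
apex. -/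
theorem isGammaPositive_thetaPoly {V : Type*} [DecidableEq V] {Δ B : FiniteComplex V}
    (hB : B.faces ⊆ Δ.faces) (hr : Δ.rank = B.rank + 1)
    (h : GammaLE B.base (Δ.coneOff B hB)) : IsGammaPositive Δ.rank (Δ.thetaPoly B) := by
  obtain ⟨g, g', hg, ⟨-, hg'⟩, hle⟩ := h
  rw [rank_base, hPoly_base] at hg
  rw [hPoly_coneOff hr, rank_coneOff hr.le] at hg'
  refine ⟨fun i => g'.coeff i - g.coeff i, fun i => sub_nonneg.2 (hle i), ?_⟩
  have e : Δ.thetaPoly B = Δ.hPoly + X * B.hPoly - (1 + X) * B.hPoly := by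
    rw [thetaPoly]; ring
  rw [e, hg', hg.one_add_X_mul, hr, ← Finset.sum_sub_distrib]
  refine Finset.sum_congr rfl fun i _ => ?_
  rw [C_sub]
  ring

theorem IsInducedSubcomplex.mono {V : Type*} {Γ Δ D : FiniteComplex V}
    (h : Γ.IsInducedSubcomplex Δ) (hΓ : Γ.faces ⊆ D.faces) (hD : D.faces ⊆ Δ.faces) :
    Γ.IsInducedSubcomplex D := ⟨hΓ, fun F hF => h.2 F (hD hF)⟩

end FiniteComplex

theorem mainTheorem12 (k : Type*) [Field k] (n : ℕ) (hn : 0 < n) :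
    List.TFAE [
      ∀ (V : Type u) [LinearOrder V] (Δ B : FiniteComplex V),
        Δ.IsFlag → Δ.IsHomologyBall k B → Δ.dim = (n : ℤ) - 1 → B.IsInducedSubcomplex Δ →
          IsGammaPositive n (Δ.thetaPoly B),
      ∀ (V : Type u) [LinearOrder V] (Δ : FiniteComplex V),
        Δ.IsFlag → Δ.IsHomologySphere k → Δ.dim = (n : ℤ) - 1 →
          ∀ (v : V) (hv : {v} ∈ Δ.faces), GammaLE (Δ.link {v} hv) Δ,
      ∀ (V : Type u) [LinearOrder V] (Δ Γ : FiniteComplex V),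
        Δ.IsFlag → Δ.IsHomologySphere k → Δ.dim = (n : ℤ) - 1 →
          Γ.IsFlag → Γ.IsHomologySphere k → Γ.dim = (n : ℤ) - 2 → Γ.IsInducedSubcomplex Δ →
            GammaLE Γ Δ] := by
  tfae_have 1 → 3 := by
    intro h V _ Δ Γ hflag hΔ hd _ hΓ hdΓ hind
    obtain rfl : Δ.rank = n := by unfold FiniteComplex.dim at hd; omega
    have hr : Γ.rank + 1 = Δ.rank := by unfold FiniteComplex.dim at hd hdΓ; omega
    obtain ⟨S₁, S₂, hdec⟩ := FiniteComplex.IsInducedSubcomplex.exists_isDecomposition hΔ hΓ hr hind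
    obtain ⟨hr1, hb1⟩ := hdec.isHomologyBall_left hΔ hΓ hr
    obtain ⟨hr2, hb2⟩ := hdec.symm.isHomologyBall_left hΔ hΓ hr
    refine FiniteComplex.IsGammaPositive.gammaLE hdec hr1 hr2 hr hΓ
      (h V _ Γ (hflag.restrict _) hb1 (by rw [FiniteComplex.dim, hr1]) ?_)
      (h V _ Γ (hflag.restrict _) hb2 (by rw [FiniteComplex.dim, hr2]) ?_)
    · exact hind.mono hdec.inter_subset_left hdec.left_subset
    · exact hind.mono hdec.inter_subset_right hdec.right_subset
  tfae_have 3 → 2 := by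
    intro h V _ Δ hflag hΔ hd v hv
    refine h V Δ _ hflag hΔ hd (hflag.link_singleton hv) (hΔ.link hv) ?_
      (hflag.isInducedSubcomplex_link_singleton hv)
    have := hΔ.rank_link_singleton hv
    unfold FiniteComplex.dim at hd ⊢
    omega
  tfae_have 2 → 1 := by
    intro h V _ Δ B hflag hball hd hind
    obtain rfl : Δ.rank = n := by unfold FiniteComplex.dim at hd; omega
    have hr := hball.rank_boundary
    refine FiniteComplex.isGammaPositive_thetaPoly hball.1 hr ?_
    have hv : {⊥} ∈ (Δ.coneOff B hball.1).faces :=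
      FiniteComplex.apexSimplex_mem_coneOff (F := ∅).2 B.empty_mem
    have hlink : (Δ.coneOff B hball.1).link {⊥} hv = B.base := by
      have e : ({⊥} : Finset (WithBot V)) = FiniteComplex.apexSimplex ∅ := rfl
      rw [FiniteComplex.link_congr _ e hv (FiniteComplex.apexSimplex_mem_coneOff.2 B.empty_mem),
        FiniteComplex.link_coneOff_apexSimplex B.empty_mem, FiniteComplex.link_empty]
    -- The cone lives on `WithBot V`, which is linearly ordered and in the same universe as `V`, so
    -- the hypothesis applies to it at the apex.
    have := h (WithBot V) _ (hflag.coneOff hind) hball.coneOff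
      (by rw [FiniteComplex.dim, FiniteComplex.rank_coneOff hr.le, hr]) ⊥ hv
    rwa [hlink] at this
  tfae_finish
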